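/- For $x\in\mathbb Z$ let $\rho_x$ be the law of the labeled plane Galton--Watson tree with offspring distribution $\mathrm{Geom}(1/2)$ (that is, $n$ children with probability $2^{-n-1}$, $n\ge 0$), in which the root has label $x$ and the label of any other vertex is uniform in $\{\ell-1,\ell,\ell+1\}$, $\ell$ being the label of its parent. Let $\theta_\infty=(T_\infty,l_\infty)$ be the uniform infinite labeled tree: the random labeled rooted plane tree with a unique infinite spine $s_0,s_1,\dots$ starting at the root $s_0$, such that the spine labels $S_i=l_\infty(s_i)$ form a random walk started from $S_0=0$ with independent uniform steps in $\{-1,0,1\}$ and, conditionally on $(S_i)_{i\ge0}$, the subtrees $L_i$ and $R_i$ attached to $s_i$ on the left and on the right of the spine are independent, with law $\rho_{S_i}$. For $k\ge 1$ let $e_k$ be the first corner of $T_\infty$ after the root corner, in clockwise (depth-first) order, whose label is $-k$; it exists almost surely. Let $x_0,x_1,\dots,x_m$ be the vertices on the path in $T_\infty$ from the vertex of $e_k$ (which is $x_0$) to the root (which is $x_m$), and let $X^{(k)}_{\infty,i}=l_\infty(x_i)+k$ for $0\le i\le m$. (Almost surely $m\ge k$, so that $X^{(k)}_{\infty,1},\dots,X^{(k)}_{\infty,r}$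 are defined as soon as $k\ge r$.) Let $\tilde X=(\tilde X_n)_{n\ge0}$ be the Markov chain on $\{1,2,3,\dots\}$ started from $\tilde X_0=1$, with transition probabilities $$\mathbb P(\tilde X_{n+1}=x+1\mid\tilde X_n=x)=\frac{(x+4)(2x+5)}{3(x+2)(2x+3)},\qquad \mathbb P(\tilde X_{n+1}=x\mid\tilde X_n=x)=\frac{x(x+3)}{3(x+1)(x+2)},$$ $$\mathbb P(\tilde X_{n+1}=x-1\mid\tilde X_n=x)=\frac{(x-1)(2x+1)}{3(x+1)(2x+3)}.$$ Then for every fixed $r$ and every bounded continuous function $F:\mathbb R^r\to\mathbb R$, $$\mathbb E\big[F(X^{(k)}_{\infty,1},\dots,X^{(k)}_{\infty,r})\big]\longrightarrow \mathbb E\big[F(\tilde X_0,\dots,\tilde X_{r-1})\big]\qquad (k\to\infty).$$ That is, the first $r$ labels along the branch from $e_k$ to the root (after $e_k$ itself) converge in distribution to the first $r$ values of the chain $\tilde X$ started at $1$. -/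

import Mathlib

open MeasureTheory ProbabilityTheory Filter Topology
open scoped ENNReal BoundedContinuousFunction

noncomputable section

namespace UIPQ

/-! ### Labeled plane trees -/

/-- A locally finite rooted plane tree with integer labels, in the Ulam--Harris encoding. Vertices
are words `u : List ℕ`: the root is `[]`, and `u ++ [i]` is the `i`-th child of `u`, counted from
the left starting at `0`. `children u` is the number of children of `u` and `label u` is its label;
the values of these functions at words that are not vertices play no role. -/
structure LabeledTree where
  children : List ℕ → ℕ
  label : List ℕ → ℤ

/-- The word `u` is a vertex of the tree `θ`. -/
def LabeledTree.IsVertex (θ : LabeledTree) (u : List ℕ) : Prop :=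
  ∀ (v : List ℕ) (i : ℕ), v ++ [i] <+: u → i < θ.children v

/-- `u` is the first vertex of `θ` with label `y` in depth-first order, that is, in the
lexicographic order on words. When it has finitely many predecessors (as it does for every tree
with a unique spine along which the labels are unbounded below, if `y` is negative and the root has
label `0`), the first visit of `u` in the clockwise contour of the tree is the first corner with
label `y` after the root corner. -/
def LabeledTree.IsFirstWithLabel (θ : LabeledTree) (y : ℤ) (u : List ℕ) : Prop :=
  θ.IsVertex u ∧ θ.label u = y ∧ ∀ v, θ.IsVertex v → v < u → θ.label v ≠ y

open Classical in
/-- The vertex `e_k(θ)` carrying the first corner with label `-k` after the root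
(the root itself, by convention, if no vertex has label `-k`). -/
def LabeledTree.firstHit (θ : LabeledTree) (k : ℕ) : List ℕ :=
  if h : ∃ u, θ.IsFirstWithLabel (-(k : ℤ)) u then h.choose else []

/-- The vertex `x_i` at distance `i` from `e_k` on the path from `e_k` to the root: the `i`-th
ancestor of `e_k` (the root itself, by convention, if `i` exceeds the height of `e_k`). -/
def LabeledTree.branch (θ : LabeledTree) (k i : ℕ) : List ℕ :=
  List.dropLast^[i] (θ.firstHit k)

/-- The shifted label `X_i^{(k)} = l(x_i) + k` of the `i`-th vertex on the branch from `e_k` to the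
root. -/
def LabeledTree.branchLabel (θ : LabeledTree) (k i : ℕ) : ℤ :=
  θ.label (θ.branch k i) + k

/-! ### Galton--Watson trees -/

/-- The randomness in a labeled Galton--Watson tree: a number of children and a label increment
for every word. -/
abbrev GWField : Type := List ℕ → ℕ × ℤ

/-- The uniform distribution on `{-1, 0, 1}`. -/
def stepLaw : Measure ℤ :=
  (PMF.uniformOfFinset ({-1, 0, 1} : Finset ℤ) (by simp)).toMeasure

instance : IsProbabilityMeasure stepLaw := by
  unfold stepLaw; infer_instance

/-- The geometric distribution `n ↦ 2⁻⁽ⁿ⁺¹⁾` on `{0, 1, 2, …}`. -/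
def offspringLaw : Measure ℕ :=
  geometricMeasure ⟨1 / 2, by constructor <;> norm_num⟩

instance : IsProbabilityMeasure offspringLaw := by
  unfold offspringLaw; infer_instance

/-- All numbers of children and all label increments are independent, the former geometric and
the latter uniform on `{-1, 0, 1}`. -/
def gwFieldLaw : Measure GWField :=
  Measure.infinitePi fun _ => offspringLaw.prod stepLaw

instance : IsProbabilityMeasure gwFieldLaw := by
  unfold gwFieldLaw; infer_instance

/-- The label of a word when the root has label `x`: the label of a vertex is that of its parent
plus the increment attached to the vertex. -/
def gwLabel : GWField → ℤ → List ℕ → ℤ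
  | _, x, [] => x
  | g, x, i :: u => gwLabel (fun v => g (i :: v)) (x + (g [i]).2) u

/-- The labeled tree with root label `x` built from `g`. Under `gwFieldLaw` its law is that of a
Galton--Watson tree with geometric offspring distribution of parameter `1/2` and uniform label
increments in `{-1, 0, 1}`. -/
def gwTree (x : ℤ) (g : GWField) : LabeledTree where
  children u := (g u).1
  label u := gwLabel g x u

/-! ### The uniform infinite labeled tree -/

/-- Number of children in the tree with a single spine `s_0, s_1, …` (`s_0` the root) in which
`L j` is grafted at `s_j` to the left of the spine and `R j` to its right, of the vertex whose word
relative to `s_j` is `u`. The children of `s_j` are, from left to right, those of the root of `L j`,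
then `s_{j+1}`, then those of the root of `R j`. -/
def graftChildren (L R : ℕ → LabeledTree) : ℕ → List ℕ → ℕ
  | j, [] => (L j).children [] + 1 + (R j).children []
  | j, i :: u =>
    if i < (L j).children [] then (L j).children (i :: u)
    else if i = (L j).children [] then graftChildren L R (j + 1) u
    else (R j).children ((i - ((L j).children [] + 1)) :: u)

/-- The labels in the same tree, those of `L j` and `R j` being kept; both have the label of `s_j`
as root label. -/
def graftLabel (L R : ℕ → LabeledTree) : ℕ → List ℕ → ℤ
  | j, [] => (L j).label []
  | j, i :: u =>
    if i < (L j).children [] then (L j).label (i :: u)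
    else if i = (L j).children [] then graftLabel L R (j + 1) u
    else (R j).label ((i - ((L j).children [] + 1)) :: u)

/-- The tree with a single spine, with `L j` and `R j` to the left and to the right of its `j`-th
vertex. -/
def graft (L R : ℕ → LabeledTree) : LabeledTree where
  children := graftChildren L R 0
  label := graftLabel L R 0

/-- The sample space of the uniform infinite labeled tree: the increments of the labels along the
spine, and the randomness in the trees to the left and to the right of the spine. -/
abbrev Sample : Type := (ℕ → ℤ) × (ℕ → GWField) × (ℕ → GWField)

/-- All of these are independent. -/
def sampleLaw : Measure Sample :=
  (Measure.infinitePi fun _ => stepLaw).prod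
    ((Measure.infinitePi fun _ => gwFieldLaw).prod (Measure.infinitePi fun _ => gwFieldLaw))

instance : IsProbabilityMeasure sampleLaw := by
  unfold sampleLaw; infer_instance

/-- The label `S_j` of the `j`-th spine vertex: a random walk from `0` with uniform steps in
`{-1, 0, 1}`. -/
def spineLabel (ω : Sample) (j : ℕ) : ℤ := ∑ i ∈ Finset.range j, ω.1 i

/-- The uniform infinite labeled tree `θ_∞`: the spine labels form a random walk and, conditionally
on them, the trees `L_j` and `R_j` are independent labeled Galton--Watson trees with root
label `S_j`. -/
def uniformInfiniteTree (ω : Sample) : LabeledTree :=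
  graft (fun j => gwTree (spineLabel ω j) (ω.2.1 j)) (fun j => gwTree (spineLabel ω j) (ω.2.2 j))

/-- The random vector `(X_{∞,1}^{(k)}, …, X_{∞,r}^{(k)})`. -/
def firstLabels (r k : ℕ) (ω : Sample) : Fin r → ℝ :=
  fun i => ((uniformInfiniteTree ω).branchLabel k (i + 1) : ℝ)

/-! ### The limiting Markov chain -/

/-- Probability of a step from `x` to `x + 1`. -/
def probUp (x : ℕ) : ℝ := ((x + 4) * (2 * x + 5)) / (3 * (x + 2) * (2 * x + 3))

/-- Probability of a step from `x` to `x`. -/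
def probStay (x : ℕ) : ℝ := (x * (x + 3)) / (3 * (x + 1) * (x + 2))

/-- Probability of a step from `x` to `x - 1`. -/
def probDown (x : ℕ) : ℝ := ((x - 1) * (2 * x + 1)) / (3 * (x + 1) * (2 * x + 3))

/-- The transition probabilities of the chain on the positive integers. The state `0`, which cannot
be reached from the positive integers since `probDown 1 = 0`, is made absorbing by convention. -/
def chainStep (x : ℕ) : Measure ℕ :=
  if x = 0 then Measure.dirac 0
  else ENNReal.ofReal (probUp x) • Measure.dirac (x + 1)
    + ENNReal.ofReal (probStay x) • Measure.dirac x
    + ENNReal.ofReal (probDown x) • Measure.dirac (x - 1)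

instance (x : ℕ) : IsProbabilityMeasure (chainStep x) := by
  constructor
  unfold chainStep
  split_ifs with h
  · simp
  · have hx : (1 : ℝ) ≤ x := by exact_mod_cast Nat.one_le_iff_ne_zero.mpr h
    have h1 : 0 ≤ probUp x := by unfold probUp; positivity
    have h2 : 0 ≤ probStay x := by unfold probStay; positivity
    have h3 : 0 ≤ probDown x := by
      unfold probDown
      have : (0 : ℝ) ≤ x - 1 := by linarith
      positivity
    simp only [Measure.coe_add, Measure.coe_smul, Pi.add_apply, Pi.smul_apply, measure_univ,
      smul_eq_mul, mul_one]
    rw [← ENNReal.ofReal_add h1 h2, ← ENNReal.ofReal_add (add_nonneg h1 h2) h3,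
      ENNReal.ofReal_eq_one]
    unfold probUp probStay probDown
    field_simp
    ring

/-- The transition kernel of the chain, as a function of the path up to time `n`. -/
def chainKernel (n : ℕ) : Kernel (Finset.Iic n → ℕ) ℕ :=
  (Kernel.ofFunOfCountable chainStep).comap
    (fun h : Finset.Iic n → ℕ => h ⟨n, by simp⟩) (measurable_pi_apply _)

instance (n : ℕ) : IsMarkovKernel (chainKernel n) := by
  have : IsMarkovKernel (Kernel.ofFunOfCountable chainStep) :=
    ⟨fun x => inferInstanceAs (IsProbabilityMeasure (chainStep x))⟩
  unfold chainKernel; infer_instance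

/-- The law of the Markov chain `(X̃_n)_{n ≥ 0}` started from `1`, on its path space. -/
def chainLaw : Measure (ℕ → ℕ) :=
  Kernel.trajMeasure (X := fun _ => ℕ) (Measure.dirac 1) chainKernel

end UIPQ

end

/-! Shift labels by `k`, so that `e_k` has label `0` and the root label `k`. On the path from the
root to `e_k`, every subtree hanging to the left avoids `0`, and nothing to the right matters. In a
Galton--Watson tree the path goes through child `i` when there are more than `i` children and the
first `i` child subtrees avoid `0`. For the geometric law `P(N > i) = P(N = i)`, so summing over `i`
gives exactly the avoidance probability of the vertex, `survival x = x(x+3)/((x+1)(x+2))`. A path of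
labels is thus weighted by the kernel `K(x, x') = survival x / 3`, `|x - x'| ≤ 1` (`transfer`,
`le_gwHitProb_succ`). In the infinite tree a path with `m` edges may leave the spine at any of its
`m + 1` vertices, whence a factor `m + 1` (`pathWeight_le_spineHitProb`).

Prescribing the first `r` labels `c` leaves the factor `green₂ k (c r) = ∑ (n+1) Kⁿ(k, c r)`. A
uniqueness principle for bounded solutions (`convex_bounded_eq_zero`) identifies `survival`, `green
k 0 = 1 - survival k → 0` and `green₂ k 0 = 1`; recursion in the second argument then gives `green₂
k y → greenLimit y` (`tendsto_toReal_green₂`). The limit is harmonic for `K` in that argument, and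
the chain is the corresponding Doob transform: its step from `a` to `b` has probability `K(b, a)
greenLimit b / greenLimit a` (`transfer_single_mul_greenLimit`).

Lower bounds suffice throughout: the limiting point masses already add up to one, so Fatou's lemma
yields convergence in law (`tendsto_of_liminf_singleton`). -/

noncomputable section

namespace UIPQ

/-! ### Subtrees and first vertices -/

namespace LabeledTree

/-- The tree of the descendants of the `i`-th child of the root. -/
def subtree (θ : LabeledTree) (i : ℕ) : LabeledTree where
  children u := θ.children (i :: u)
  label u := θ.label (i :: u)

/-- No vertex of `θ` has label `y`. -/
def Avoids (θ : LabeledTree) (y : ℤ) : Prop :=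
  ∀ v, θ.IsVertex v → θ.label v ≠ y

theorem isVertex_nil (θ : LabeledTree) : θ.IsVertex [] := by
  intro v i h
  simp at h

theorem isVertex_cons (θ : LabeledTree) (i : ℕ) (u : List ℕ) :
    θ.IsVertex (i :: u) ↔ i < θ.children [] ∧ (θ.subtree i).IsVertex u := by
  constructor
  · intro h
    refine ⟨h [] i (by simp), fun v j hv => h (i :: v) j (by simpa using hv)⟩
  · rintro ⟨hi, h⟩ v j hv
    cases v with
    | nil =>
      have : j = i := by simpa using hv
      exact this ▸ hi
    | cons a v =>
      have hv' : a = i ∧ v ++ [j] <+: u := by simpa using hv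
      obtain ⟨rfl, hv'⟩ := hv'
      exact h v j hv'

theorem avoids_iff (θ : LabeledTree) (y : ℤ) :
    θ.Avoids y ↔ θ.label [] ≠ y ∧ ∀ i < θ.children [], (θ.subtree i).Avoids y := by
  constructor
  · intro h
    exact ⟨h [] θ.isVertex_nil, fun i hi v hv => h (i :: v) ((θ.isVertex_cons i v).2 ⟨hi, hv⟩)⟩
  · rintro ⟨h0, h⟩ v hv
    cases v with
    | nil => exact h0
    | cons i v =>
      obtain ⟨hi, hv⟩ := (θ.isVertex_cons i v).1 hv
      exact h i hi v hv

theorem isFirstWithLabel_nil (θ : LabeledTree) (y : ℤ) :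
    θ.IsFirstWithLabel y [] ↔ θ.label [] = y := by
  constructor
  · exact fun h => h.2.1
  · exact fun h => ⟨θ.isVertex_nil, h, fun v _ hv => absurd hv (List.not_lt_nil v)⟩

theorem isFirstWithLabel_cons (θ : LabeledTree) (y : ℤ) (i : ℕ) (u : List ℕ) :
    θ.IsFirstWithLabel y (i :: u) ↔ θ.label [] ≠ y ∧ i < θ.children [] ∧
      (∀ j < i, (θ.subtree j).Avoids y) ∧ (θ.subtree i).IsFirstWithLabel y u := by
  constructor
  · rintro ⟨hv, hl, hf⟩
    obtain ⟨hi, hu⟩ := (θ.isVertex_cons i u).1 hv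
    refine ⟨hf [] θ.isVertex_nil (List.nil_lt_cons _ _), hi, fun j hj v hv => ?_, hu, hl,
      fun v hv hlt => ?_⟩
    · exact hf (j :: v) ((θ.isVertex_cons j v).2 ⟨hj.trans hi, hv⟩)
        (List.cons_lt_cons_iff.2 (Or.inl hj))
    · exact hf (i :: v) ((θ.isVertex_cons i v).2 ⟨hi, hv⟩)
        (List.cons_lt_cons_iff.2 (Or.inr ⟨rfl, hlt⟩))
  · rintro ⟨h0, hi, hav, hu, hl, hf⟩
    refine ⟨(θ.isVertex_cons i u).2 ⟨hi, hu⟩, hl, fun v hv hlt => ?_⟩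
    cases v with
    | nil => exact h0
    | cons j v =>
      obtain ⟨hj, hv⟩ := (θ.isVertex_cons j v).1 hv
      rcases List.cons_lt_cons_iff.1 hlt with h | ⟨rfl, h⟩
      · exact hav j h v hv
      · exact hf v hv h

theorem IsFirstWithLabel.unique {θ : LabeledTree} {y : ℤ} {u v : List ℕ}
    (hu : θ.IsFirstWithLabel y u) (hv : θ.IsFirstWithLabel y v) : u = v := by
  rcases lt_trichotomy u v with h | h | h
  · exact absurd hu.2.1 (hv.2.2 u hu.1 h)
  · exact h
  · exact absurd hv.2.1 (hu.2.2 v hv.1 h)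

theorem firstHit_eq {θ : LabeledTree} {k : ℕ} {u : List ℕ}
    (hu : θ.IsFirstWithLabel (-(k : ℤ)) u) : θ.firstHit k = u := by
  have h : ∃ u, θ.IsFirstWithLabel (-(k : ℤ)) u := ⟨u, hu⟩
  rw [firstHit, dif_pos h]
  exact h.choose_spec.unique hu

/-- The first vertex `u` of `θ` with label `y` exists and has height `m`, and for `i ≤ m` the label
of its `i`-th ancestor is `y + a` for some `a` with `C i a`. -/
def HitsAlong (θ : LabeledTree) (y : ℤ) (C : ℕ → ℕ → Prop) (m : ℕ) : Prop :=
  ∃ u, θ.IsFirstWithLabel y u ∧ u.length = m ∧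
    ∀ i ≤ m, ∃ a : ℕ, C i a ∧ θ.label (List.dropLast^[i] u) = y + a

theorem HitsAlong.height_unique {θ : LabeledTree} {y : ℤ} {C C' : ℕ → ℕ → Prop} {m m' : ℕ}
    (h : θ.HitsAlong y C m) (h' : θ.HitsAlong y C' m') : m = m' := by
  obtain ⟨u, hu, rfl, -⟩ := h
  obtain ⟨v, hv, rfl, -⟩ := h'
  rw [hu.unique hv]

theorem HitsAlong.not_avoids {θ : LabeledTree} {y : ℤ} {C : ℕ → ℕ → Prop} {m : ℕ}
    (h : θ.HitsAlong y C m) : ¬ θ.Avoids y := by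
  obtain ⟨u, hu, -⟩ := h
  exact fun h => h u hu.1 hu.2.1

theorem hitsAlong_zero {θ : LabeledTree} {y : ℤ} {C : ℕ → ℕ → Prop} (h : θ.label [] = y)
    (hC : C 0 0) : θ.HitsAlong y C 0 := by
  refine ⟨[], (θ.isFirstWithLabel_nil y).2 h, rfl, fun i hi => ⟨0, ?_, ?_⟩⟩
  · rwa [Nat.le_zero.1 hi]
  · obtain rfl := Nat.le_zero.1 hi
    simpa using h

/-- The bound on `i` is sharp: one more `dropLast` would remove `j` itself. -/
theorem dropLast_iterate_cons (j : ℕ) (v : List ℕ) (i : ℕ) (hi : i ≤ v.length) :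
    List.dropLast^[i] (j :: v) = j :: List.dropLast^[i] v := by
  induction i with
  | zero => rfl
  | succ i ih =>
    rw [Function.iterate_succ_apply', Function.iterate_succ_apply', ih (by omega)]
    have : (List.dropLast^[i] v).length = v.length - i := by
      clear ih
      induction i with
      | zero => rfl
      | succ i ih =>
        rw [Function.iterate_succ_apply', List.length_dropLast, ih (by omega)]
        omega
    rw [List.dropLast_cons_of_ne_nil]
    intro h
    rw [h] at this
    simp at this
    omega

theorem dropLast_iterate_length (v : List ℕ) : List.dropLast^[v.length] v = [] := by
  induction v with
  | nil => rfl
  | cons a v ih =>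
    rw [List.length_cons, Function.iterate_succ_apply', dropLast_iterate_cons _ _ _ le_rfl, ih]
    rfl

theorem hitsAlong_cons {θ : LabeledTree} {y : ℤ} {C : ℕ → ℕ → Prop} {m x i : ℕ}
    (h0 : θ.label [] = y + x) (hx : x ≠ 0) (hC : C (m + 1) x) (hi : i < θ.children [])
    (hav : ∀ j < i, (θ.subtree j).Avoids y) (h : (θ.subtree i).HitsAlong y C m) :
    θ.HitsAlong y C (m + 1) := by
  obtain ⟨u, hu, rfl, hl⟩ := h
  refine ⟨i :: u, (θ.isFirstWithLabel_cons y i u).2 ⟨by rw [h0]; simpa using hx, hi, hav, hu⟩,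
    rfl, fun j hj => ?_⟩
  rcases hj.lt_or_eq with hj | rfl
  · rw [dropLast_iterate_cons i u j (by omega)]
    exact hl j (by omega)
  · refine ⟨x, hC, ?_⟩
    rw [Function.iterate_succ_apply', dropLast_iterate_cons i u _ le_rfl, ← h0]
    rw [dropLast_iterate_length]
    rfl

theorem HitsAlong.exists_cons {θ : LabeledTree} {y : ℤ} {C : ℕ → ℕ → Prop} {m : ℕ}
    (h : θ.HitsAlong y C (m + 1)) : ∃ i, i < θ.children [] ∧
      (∀ j < i, (θ.subtree j).Avoids y) ∧ (θ.subtree i).HitsAlong y C m ∧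
      ∃ a : ℕ, C (m + 1) a ∧ θ.label [] = y + a := by
  obtain ⟨u, hu, hlen, hl⟩ := h
  cases u with
  | nil => simp at hlen
  | cons i u =>
    simp only [List.length_cons, Nat.add_right_cancel_iff] at hlen
    subst hlen
    obtain ⟨-, hi, hav, hfu⟩ := (θ.isFirstWithLabel_cons y i u).1 hu
    refine ⟨i, hi, hav, ⟨u, hfu, rfl, fun j hj => ?_⟩, ?_⟩
    · have := hl j (by omega)
      rwa [dropLast_iterate_cons i u j hj] at this
    · have := hl (u.length + 1) le_rfl
      have h2 := dropLast_iterate_length (i :: u)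
      rw [List.length_cons] at h2
      rwa [h2] at this

theorem HitsAlong.branchLabel_eq {θ : LabeledTree} {k : ℕ} {C : ℕ → ℕ → Prop} {m : ℕ}
    (h : θ.HitsAlong (-(k : ℤ)) C m) {i : ℕ} (hi : i ≤ m) :
    ∃ a : ℕ, C i a ∧ θ.branchLabel k i = a := by
  obtain ⟨u, hu, hlen, hl⟩ := h
  obtain ⟨a, ha, hla⟩ := hl i hi
  refine ⟨a, ha, ?_⟩
  rw [branchLabel, branch, firstHit_eq hu, hla]
  ring

end LabeledTree

/-! ### Decomposition of the trees at the root -/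

/-- The infinite tree with root label `x`. -/
def spineTree (x : ℤ) (ω : Sample) : LabeledTree :=
  graft (fun j => gwTree (x + spineLabel ω j) (ω.2.1 j))
    (fun j => gwTree (x + spineLabel ω j) (ω.2.2 j))

/-- The sample from the second spine vertex on. -/
def shift (ω : Sample) : Sample :=
  (fun n => ω.1 (n + 1), fun n => ω.2.1 (n + 1), fun n => ω.2.2 (n + 1))

/-- An arbitrary root label is what makes induction along the spine possible: above the next spine
vertex the tree has the same form, with another root label. -/
theorem spineTree_zero (ω : Sample) : spineTree 0 ω = uniformInfiniteTree ω := by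
  simp only [spineTree, uniformInfiniteTree, zero_add]

theorem graftChildren_succ (L R : ℕ → LabeledTree) (j : ℕ) (u : List ℕ) :
    graftChildren L R (j + 1) u
      = graftChildren (fun n => L (n + 1)) (fun n => R (n + 1)) j u := by
  induction u generalizing j with
  | nil => rfl
  | cons i u ih => simp only [graftChildren, ih]

theorem graftLabel_succ (L R : ℕ → LabeledTree) (j : ℕ) (u : List ℕ) :
    graftLabel L R (j + 1) u = graftLabel (fun n => L (n + 1)) (fun n => R (n + 1)) j u := by
  induction u generalizing j with
  | nil => rfl
  | cons i u ih => simp only [graftLabel, ih]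

theorem graft_subtree_left (L R : ℕ → LabeledTree) {i : ℕ} (hi : i < (L 0).children []) :
    (graft L R).subtree i = (L 0).subtree i := by
  simp [graft, LabeledTree.subtree, graftChildren, graftLabel, hi]

theorem graft_subtree_spine (L R : ℕ → LabeledTree) :
    (graft L R).subtree ((L 0).children []) =
      graft (fun n => L (n + 1)) (fun n => R (n + 1)) := by
  simp [graft, LabeledTree.subtree, graftChildren, graftLabel, graftChildren_succ, graftLabel_succ]

theorem spineLabel_succ (ω : Sample) (j : ℕ) :
    spineLabel ω (j + 1) = ω.1 0 + spineLabel (shift ω) j := by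
  rw [spineLabel, Finset.sum_range_succ', add_comm]
  rfl

theorem spineTree_label_nil (x : ℤ) (ω : Sample) : (spineTree x ω).label [] = x := by
  simp [spineTree, graft, graftLabel, gwTree, gwLabel, spineLabel]

theorem spineTree_children_nil (x : ℤ) (ω : Sample) :
    (spineTree x ω).children [] =
      (gwTree x (ω.2.1 0)).children [] + 1 + (gwTree x (ω.2.2 0)).children [] := rfl

theorem spineTree_subtree_left (x : ℤ) (ω : Sample) {i : ℕ}
    (hi : i < (gwTree x (ω.2.1 0)).children []) :
    (spineTree x ω).subtree i = (gwTree x (ω.2.1 0)).subtree i := by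
  rw [spineTree, graft_subtree_left]
  · simp [spineLabel]
  · exact hi

theorem spineTree_subtree_spine (x : ℤ) (ω : Sample) :
    (spineTree x ω).subtree ((gwTree x (ω.2.1 0)).children []) =
      spineTree (x + ω.1 0) (shift ω) := by
  have := graft_subtree_spine (fun j => gwTree (x + spineLabel ω j) (ω.2.1 j))
    (fun j => gwTree (x + spineLabel ω j) (ω.2.2 j))
  simp only [spineLabel_succ] at this
  simp only [spineTree, add_assoc]
  exact this

/-- The left tree is explored before the rest of the spine and before the right tree. Its root is
identified with the spine vertex, so a hit at positive height lies in one of its child subtrees,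
which are grafted unchanged. -/
theorem spineTree_hitsAlong_left {x : ℤ} {ω : Sample} {y : ℤ} {C : ℕ → ℕ → Prop} {m : ℕ}
    (hx : x ≠ y) (h : (gwTree x (ω.2.1 0)).HitsAlong y C (m + 1)) :
    (spineTree x ω).HitsAlong y C (m + 1) := by
  obtain ⟨i, hi, hav, hh, a, hC, ha⟩ := h.exists_cons
  have ha' : x = y + a := ha
  refine LabeledTree.hitsAlong_cons (x := a) (i := i) (by rw [spineTree_label_nil, ha'])
    ?_ hC ?_ (fun j hj => ?_) ?_
  · rintro rfl
    simp at ha'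
    exact hx ha'
  · rw [spineTree_children_nil]; omega
  · rw [spineTree_subtree_left x ω (hj.trans hi)]
    exact hav j hj
  · rwa [spineTree_subtree_left x ω hi]

theorem spineTree_hitsAlong_spine {x : ℕ} {ω : Sample} {y : ℤ} {C : ℕ → ℕ → Prop} {m : ℕ}
    (hx : x ≠ 0) (hC : C (m + 1) x) (hav : (gwTree (y + x) (ω.2.1 0)).Avoids y)
    (h : (spineTree (y + x + ω.1 0) (shift ω)).HitsAlong y C m) :
    (spineTree (y + x) ω).HitsAlong y C (m + 1) := by
  refine LabeledTree.hitsAlong_cons (i := (gwTree (y + x) (ω.2.1 0)).children [])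
    (spineTree_label_nil _ _) hx hC ?_ (fun j hj => ?_) ?_
  · rw [spineTree_children_nil]; omega
  · rw [spineTree_subtree_left _ ω hj]
    exact ((LabeledTree.avoids_iff _ _).1 hav).2 j hj
  · rwa [spineTree_subtree_spine]

/-! ### Measurability -/

/-- A random tree all of whose numbers of children and labels are measurable. -/
structure MeasurableTree {Ω : Type*} [MeasurableSpace Ω] (θ : Ω → LabeledTree) : Prop where
  children : ∀ u, Measurable fun ω => (θ ω).children u
  label : ∀ u, Measurable fun ω => (θ ω).label u

namespace MeasurableTree

variable {Ω : Type*} [MeasurableSpace Ω] {θ : Ω → LabeledTree}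

theorem isVertex (h : MeasurableTree θ) (u : List ℕ) :
    Measurable fun ω => (θ ω).IsVertex u := by
  unfold LabeledTree.IsVertex
  refine Measurable.forall fun v => Measurable.forall fun i => measurable_const.imp ?_
  exact measurableSet_setOfPred.1 (measurableSet_lt measurable_const (h.children v))

theorem label_eq (h : MeasurableTree θ) (u : List ℕ) (y : ℤ) :
    Measurable fun ω => (θ ω).label u = y :=
  measurableSet_setOfPred.1 (h.label u (measurableSet_singleton y))

theorem avoids (h : MeasurableTree θ) (y : ℤ) : Measurable fun ω => (θ ω).Avoids y := by
  unfold LabeledTree.Avoids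
  exact Measurable.forall fun v => (h.isVertex v).imp (h.label_eq v y).not

theorem isFirstWithLabel (h : MeasurableTree θ) (y : ℤ) (u : List ℕ) :
    Measurable fun ω => (θ ω).IsFirstWithLabel y u := by
  unfold LabeledTree.IsFirstWithLabel
  exact (h.isVertex u).and ((h.label_eq u y).and
    (Measurable.forall fun v => (h.isVertex v).imp (measurable_const.imp (h.label_eq v y).not)))

theorem hitsAlong (h : MeasurableTree θ) (y : ℤ) (C : ℕ → ℕ → Prop) (m : ℕ) :
    Measurable fun ω => (θ ω).HitsAlong y C m := by
  unfold LabeledTree.HitsAlong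
  exact Measurable.exists fun u => (h.isFirstWithLabel y u).and (measurable_const.and
    (Measurable.forall fun i => measurable_const.imp
      (Measurable.exists fun a => measurable_const.and (h.label_eq _ _))))

/-- The first vertex is unique, so the choice in `firstHit` is canonical; the default value `[]`
accounts for the second alternative in `hset`. -/
theorem firstHit_eq (h : MeasurableTree θ) (k : ℕ) (u : List ℕ) :
    Measurable fun ω => (θ ω).firstHit k = u := by
  have key : ∀ u, Measurable fun ω => (θ ω).IsFirstWithLabel (-(k : ℤ)) u :=
    h.isFirstWithLabel _
  have hset : ∀ ω, (θ ω).firstHit k = u ↔ (θ ω).IsFirstWithLabel (-(k : ℤ)) u ∨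
      (u = [] ∧ ∀ v, ¬ (θ ω).IsFirstWithLabel (-(k : ℤ)) v) := by
    intro ω
    by_cases hex : ∃ v, (θ ω).IsFirstWithLabel (-(k : ℤ)) v
    · obtain ⟨v, hv⟩ := hex
      rw [LabeledTree.firstHit_eq hv]
      constructor
      · rintro rfl; exact Or.inl hv
      · rintro (hu | ⟨-, hu⟩)
        · exact hv.unique hu
        · exact absurd hv (hu v)
    · rw [LabeledTree.firstHit, dif_neg hex]
      push Not at hex
      constructor
      · rintro rfl; exact Or.inr ⟨rfl, hex⟩
      · rintro (hu | ⟨rfl, -⟩)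
        · exact absurd hu (hex u)
        · rfl
  simp only [hset]
  exact (key u).or (measurable_const.and (Measurable.forall fun v => (key v).not))

theorem branchLabel (h : MeasurableTree θ) (k i : ℕ) :
    Measurable fun ω => (θ ω).branchLabel k i := by
  refine measurable_to_countable' fun z => ?_
  have : (fun ω => (θ ω).branchLabel k i) ⁻¹' {z} = {ω | ∃ u, (θ ω).firstHit k = u ∧
      (θ ω).label (List.dropLast^[i] u) = z - k} := by
    ext ω
    simp [LabeledTree.branchLabel, LabeledTree.branch, eq_sub_iff_add_eq]
  rw [this]
  exact measurableSet_setOfPred.2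
    (Measurable.exists fun u => (h.firstHit_eq k u).and (h.label_eq _ _))

end MeasurableTree

theorem measurable_gwLabel {Ω : Type*} [MeasurableSpace Ω] (u : List ℕ) {φ : Ω → GWField}
    {ξ : Ω → ℤ} (hφ : Measurable φ) (hξ : Measurable ξ) :
    Measurable fun ω => gwLabel (φ ω) (ξ ω) u := by
  induction u generalizing φ ξ with
  | nil => exact hξ
  | cons i u ih =>
    simp only [gwLabel]
    exact ih (measurable_pi_lambda _ fun v => (measurable_pi_apply _).comp hφ)
      (hξ.add (measurable_snd.comp ((measurable_pi_apply _).comp hφ)))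

theorem measurableTree_gwTree {Ω : Type*} [MeasurableSpace Ω] {φ : Ω → GWField}
    {ξ : Ω → ℤ} (hφ : Measurable φ) (hξ : Measurable ξ) :
    MeasurableTree fun ω => gwTree (ξ ω) (φ ω) where
  children u := measurable_fst.comp ((measurable_pi_apply u).comp hφ)
  label u := measurable_gwLabel u hφ hξ

theorem measurableTree_graft {Ω : Type*} [MeasurableSpace Ω] {L R : Ω → ℕ → LabeledTree}
    (hL : ∀ j, MeasurableTree fun ω => L ω j) (hR : ∀ j, MeasurableTree fun ω => R ω j) :
    MeasurableTree fun ω => graft (L ω) (R ω) := by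
  constructor
  · suffices h : ∀ u j, Measurable fun ω => graftChildren (L ω) (R ω) j u from fun u => h u 0
    intro u
    induction u with
    | nil => exact fun j => (((hL j).children []).add_const 1).add ((hR j).children [])
    | cons i u ih =>
      intro j
      simp only [graftChildren]
      have h0 := (hL j).children []
      have h1 : Measurable fun p : Ω × ℕ => (R p.1 j).children (p.2 :: u) :=
        measurable_from_prod_countable_left fun n => (hR j).children (n :: u)
      refine Measurable.ite (measurableSet_lt measurable_const h0) ((hL j).children _)
        (Measurable.ite (measurableSet_eq_fun measurable_const h0) (ih _) ?_)
      exact h1.comp (measurable_id.prodMk ((Measurable.of_discrete (f := fun n => i - (n + 1))).comp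
        h0))
  · suffices h : ∀ u j, Measurable fun ω => graftLabel (L ω) (R ω) j u from fun u => h u 0
    intro u
    induction u with
    | nil => exact fun j => (hL j).label []
    | cons i u ih =>
      intro j
      simp only [graftLabel]
      have h0 := (hL j).children []
      have h1 : Measurable fun p : Ω × ℕ => (R p.1 j).label (p.2 :: u) :=
        measurable_from_prod_countable_left fun n => (hR j).label (n :: u)
      refine Measurable.ite (measurableSet_lt measurable_const h0) ((hL j).label _)
        (Measurable.ite (measurableSet_eq_fun measurable_const h0) (ih _) ?_)
      exact h1.comp (measurable_id.prodMk ((Measurable.of_discrete (f := fun n => i - (n + 1))).comp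
        h0))

theorem measurableTree_spineTree {Ω : Type*} [MeasurableSpace Ω] {φ : Ω → Sample} {ξ : Ω → ℤ}
    (hφ : Measurable φ) (hξ : Measurable ξ) : MeasurableTree fun ω => spineTree (ξ ω) (φ ω) := by
  have hS : ∀ j, Measurable fun ω => ξ ω + spineLabel (φ ω) j := fun j => by
    unfold spineLabel
    exact hξ.add (Finset.measurable_sum _ fun i _ =>
      (measurable_pi_apply i).comp (measurable_fst.comp hφ))
  exact measurableTree_graft
    (fun j => measurableTree_gwTree
      ((measurable_pi_apply j).comp (measurable_fst.comp (measurable_snd.comp hφ))) (hS j))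
    (fun j => measurableTree_gwTree
      ((measurable_pi_apply j).comp (measurable_snd.comp (measurable_snd.comp hφ))) (hS j))

theorem measurable_firstLabels (r k : ℕ) : Measurable (firstLabels r k) := by
  refine measurable_pi_lambda _ fun i => ?_
  have h : MeasurableTree uniformInfiniteTree := by
    have := measurableTree_spineTree (φ := id) (ξ := fun _ => 0) measurable_id measurable_const
    simpa only [spineTree_zero, id] using this
  exact (Measurable.of_discrete (f := fun z : ℤ => (z : ℝ))).comp (h.branchLabel k (i + 1))

/-! ### Decompositions of product measures -/

/-- Splits one coordinate `i₀` off a power of `μ`, with `e` enumerating the others. It serves both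
for the root word of a field and for index `0` of a sequence. -/
theorem measurePreserving_infinitePi_cons {ι κ X : Type*} [MeasurableSpace X] (μ : Measure X)
    [IsProbabilityMeasure μ] (i₀ : ι) (e : κ → ι) (he : Function.Injective e)
    (hr : ∀ i, i ≠ i₀ → i ∈ Set.range e) (hne : ∀ k, e k ≠ i₀) (Φ : X × (κ → X) → ι → X)
    (h0 : ∀ p, Φ p i₀ = p.1) (hs : ∀ p k, Φ p (e k) = p.2 k) :
    MeasurePreserving Φ (μ.prod (Measure.infinitePi fun _ => μ))
      (Measure.infinitePi fun _ => μ) := by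
  classical
  have hΦ : Measurable Φ := by
    refine measurable_pi_iff.2 fun i => ?_
    by_cases hi : i = i₀
    · subst hi
      simp only [h0]
      exact measurable_fst
    · obtain ⟨k, rfl⟩ := hr i hi
      simp only [hs]
      exact (measurable_pi_apply k).comp measurable_snd
  refine ⟨hΦ, Measure.eq_infinitePi _ fun s t ht => ?_⟩
  have hpre : Φ ⁻¹' (Set.pi s t) = (if i₀ ∈ s then t i₀ else Set.univ) ×ˢ
      Set.pi ((s.erase i₀).preimage e he.injOn : Finset κ) (fun k => t (e k)) := by
    ext p
    simp only [Set.mem_preimage, Set.mem_pi, Set.mem_prod, Finset.coe_preimage, Finset.coe_erase]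
    constructor
    · intro h
      refine ⟨?_, fun k hk => ?_⟩
      · split_ifs with hi
        · rw [← h0 p]; exact h _ hi
        · trivial
      · rw [← hs p]; exact h _ hk.1
    · rintro ⟨h1, h2⟩ i hi
      by_cases hi0 : i = i₀
      · subst hi0
        rw [if_pos (by exact hi)] at h1
        rwa [h0]
      · obtain ⟨k, rfl⟩ := hr i hi0
        rw [hs]
        exact h2 k ⟨hi, hi0⟩
  rw [Measure.map_apply hΦ (MeasurableSet.pi s.countable_toSet fun i _ => ht i), hpre,
    Measure.prod_prod, Measure.infinitePi_pi _ (fun k _ => ht (e k)),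
    Finset.prod_preimage e (s.erase i₀) he.injOn (fun i => μ (t i))
      (fun i hi hi' => absurd (hr i (Finset.ne_of_mem_erase hi)) hi')]
  split_ifs with hi
  · exact Finset.mul_prod_erase s (fun i => μ (t i)) hi
  · rw [Finset.erase_eq_of_notMem hi, measure_univ, one_mul]

theorem measurePreserving_prodProdProdComm {α β γ δ : Type*} [MeasurableSpace α]
    [MeasurableSpace β] [MeasurableSpace γ] [MeasurableSpace δ] (μ : Measure α) (ν : Measure β)
    (μ' : Measure γ) (ν' : Measure δ) [SFinite μ] [SFinite ν] [SFinite μ'] [SFinite ν'] :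
    MeasurePreserving (fun p : (α × β) × (γ × δ) => ((p.1.1, p.2.1), (p.1.2, p.2.2)))
      ((μ.prod ν).prod (μ'.prod ν')) ((μ.prod μ').prod (ν.prod ν')) := by
  have hm : Measurable (fun p : (α × β) × (γ × δ) => ((p.1.1, p.2.1), (p.1.2, p.2.2))) := by
    fun_prop
  refine ⟨hm, Measure.ext_of_lintegral _ fun f hf => ?_⟩
  rw [lintegral_map hf hm]
  have e1 : ∫⁻ p : (α × β) × (γ × δ), f ((p.1.1, p.2.1), (p.1.2, p.2.2))
        ∂((μ.prod ν).prod (μ'.prod ν')) =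
      ∫⁻ a, ∫⁻ b, ∫⁻ c, ∫⁻ d, f ((a, c), (b, d)) ∂ν' ∂μ' ∂ν ∂μ := by
    rw [lintegral_prod _ (by fun_prop), lintegral_prod _ (by fun_prop)]
    exact lintegral_congr fun a => lintegral_congr fun b => lintegral_prod _ (by fun_prop)
  have e2 : ∫⁻ p, f p ∂((μ.prod μ').prod (ν.prod ν')) =
      ∫⁻ a, ∫⁻ c, ∫⁻ b, ∫⁻ d, f ((a, c), (b, d)) ∂ν' ∂ν ∂μ' ∂μ := by
    rw [lintegral_prod _ (by fun_prop), lintegral_prod _ (by fun_prop)]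
    exact lintegral_congr fun a => lintegral_congr fun b => lintegral_prod _ (by fun_prop)
  rw [e1, e2]
  exact lintegral_congr fun a => lintegral_lintegral_swap (by fun_prop)

/-- The field with the given label increment and number of children of the root, and the given
fields above the children of the root. -/
def consField (p : ℤ × ℕ × (ℕ → GWField)) : GWField
  | [] => (p.2.1, p.1)
  | i :: u => p.2.2 i u

theorem measurePreserving_consField :
    MeasurePreserving consField (stepLaw.prod (offspringLaw.prod
      (Measure.infinitePi fun _ : ℕ => gwFieldLaw))) gwFieldLaw := by
  have h1 := measurePreserving_infinitePi_cons (offspringLaw.prod stepLaw) ([] : List ℕ)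
    (fun k : ℕ × List ℕ => k.1 :: k.2) (fun a b h => by
      rw [List.cons.injEq] at h; exact Prod.ext h.1 h.2)
    (fun i hi => by cases i with | nil => exact absurd rfl hi | cons i u => exact ⟨(i, u), rfl⟩)
    (fun k => List.cons_ne_nil _ _)
    (fun p u => match u with | [] => p.1 | i :: u => p.2 (i, u)) (fun _ => rfl) (fun _ _ => rfl)
  have h2 : MeasurePreserving (MeasurableEquiv.curry ℕ (List ℕ) (ℕ × ℤ)).symm
      (Measure.infinitePi fun _ : ℕ => gwFieldLaw)
      (Measure.infinitePi fun _ : ℕ × List ℕ => offspringLaw.prod stepLaw) :=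
    ⟨MeasurableEquiv.measurable _,
      Measure.infinitePi_map_curry_symm fun _ _ => offspringLaw.prod stepLaw⟩
  -- A field stores the number of children before the increment, whereas `consField` takes the
  -- increment first.
  have h3 := ((Measure.measurePreserving_swap (μ := stepLaw) (ν := offspringLaw)).prod h2)
  have h4 := (measurePreserving_prodAssoc stepLaw offspringLaw
    (Measure.infinitePi fun _ : ℕ => gwFieldLaw)).symm
  have h5 := h1.comp (h3.comp h4)
  convert! h5 using 1

/-- The sample with given first spine step and first trees on both sides. -/
def consSample (p : (ℤ × GWField × GWField) × Sample) : Sample :=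
  (fun n => n.casesOn p.1.1 p.2.1, fun n => n.casesOn p.1.2.1 p.2.2.1,
    fun n => n.casesOn p.1.2.2 p.2.2.2)

theorem measurePreserving_infinitePi_nat {X : Type*} [MeasurableSpace X] (μ : Measure X)
    [IsProbabilityMeasure μ] :
    MeasurePreserving (fun (p : X × (ℕ → X)) (n : ℕ) => (n.casesOn p.1 p.2 : X))
      (μ.prod (Measure.infinitePi fun _ => μ)) (Measure.infinitePi fun _ => μ) :=
  measurePreserving_infinitePi_cons μ 0 Nat.succ Nat.succ_injective
    (fun i hi => ⟨i - 1, by simp; omega⟩) (fun k => Nat.succ_ne_zero k) _ (fun _ => rfl)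
    (fun _ _ => rfl)

theorem measurePreserving_consSample :
    MeasurePreserving consSample
      ((stepLaw.prod (gwFieldLaw.prod gwFieldLaw)).prod sampleLaw) sampleLaw := by
  have h1 := (measurePreserving_infinitePi_nat gwFieldLaw).prod
    (measurePreserving_infinitePi_nat gwFieldLaw)
  have h2 := h1.comp (measurePreserving_prodProdProdComm gwFieldLaw gwFieldLaw
    (Measure.infinitePi fun _ : ℕ => gwFieldLaw) (Measure.infinitePi fun _ : ℕ => gwFieldLaw))
  have h3 := ((measurePreserving_infinitePi_nat stepLaw).prod h2).comp
    (measurePreserving_prodProdProdComm stepLaw (gwFieldLaw.prod gwFieldLaw)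
      (Measure.infinitePi fun _ : ℕ => stepLaw) ((Measure.infinitePi fun _ : ℕ => gwFieldLaw).prod
        (Measure.infinitePi fun _ : ℕ => gwFieldLaw)))
  exact h3

/-! ### Offspring and step laws -/

theorem offspringLaw_singleton (n : ℕ) : offspringLaw {n} = 2⁻¹ ^ (n + 1) := by
  have h := geometricMeasure_singleton
    (p := ⟨1 / 2, by constructor <;> norm_num⟩) (by intro h; simpa using congrArg Subtype.val h) n
  rw [offspringLaw, h]
  have : ((1 : ℝ) - 1 / 2) ^ n * (1 / 2) = 2⁻¹ ^ (n + 1) := by rw [pow_succ]; norm_num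
  simp only [this]
  rw [ENNReal.ofReal_pow (by norm_num), ENNReal.ofReal_inv_of_pos (by norm_num)]
  norm_num

/-- Equality with the mass of `{n}` is the special feature of parameter `1/2` on which the whole
computation rests. -/
theorem offspringLaw_Ioi (n : ℕ) : offspringLaw (Set.Ioi n) = 2⁻¹ ^ (n + 1) := by
  have half (n : ℕ) : (2⁻¹ : ℝ≥0∞) ^ (n + 1) + 2⁻¹ ^ (n + 1) = 2⁻¹ ^ n := by
    rw [pow_succ, ← mul_add, ENNReal.inv_two_add_inv_two, mul_one]
  have hsplit (n : ℕ) : offspringLaw (Set.Ici n) = 2⁻¹ ^ (n + 1) + offspringLaw (Set.Ioi n) := by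
    rw [← offspringLaw_singleton, ← measure_union (by simp) measurableSet_Ioi]
    congr 1
    ext x
    simp only [Set.mem_Ici, Set.mem_union, Set.mem_singleton_iff, Set.mem_Ioi]
    omega
  have hfin (n : ℕ) : (2⁻¹ : ℝ≥0∞) ^ n ≠ ∞ := ENNReal.pow_ne_top (by simp)
  have hIci (n : ℕ) : offspringLaw (Set.Ici n) = 2⁻¹ ^ n := by
    induction n with
    | zero =>
      rw [show Set.Ici (0 : ℕ) = Set.univ by ext; simp]
      simp
    | succ n ih =>
      rw [hsplit, ← half n, ENNReal.add_right_inj (hfin _)] at ih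
      rw [← ih]
      rfl
  have h := hsplit n
  rw [hIci, ← half, ENNReal.add_right_inj (hfin _)] at h
  exact h.symm

theorem lintegral_stepLaw (f : ℤ → ℝ≥0∞) :
    ∫⁻ d, f d ∂stepLaw = 3⁻¹ * (f (-1) + f 0 + f 1) := by
  have hs : ∀ d, stepLaw {d} = if d ∈ ({-1, 0, 1} : Finset ℤ) then 3⁻¹ else 0 := fun d => by
    rw [stepLaw, PMF.toMeasure_apply_singleton _ _ (measurableSet_singleton d),
      PMF.uniformOfFinset_apply]
    congr
  rw [lintegral_countable', tsum_eq_sum (s := ({-1, 0, 1} : Finset ℤ))]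
  · simp only [hs]
    rw [Finset.sum_insert (by decide), Finset.sum_insert (by decide), Finset.sum_singleton]
    simp
    ring
  · intro d hd
    rw [hs, if_neg hd, mul_zero]

/-! ### Recursions for the first vertex with a given label -/

/-- The increment at the root word is never read, the root label being prescribed; it is therefore
independent of the tree. -/
theorem gwTree_consField (x d : ℤ) (q : ℕ × (ℕ → GWField)) :
    gwTree x (consField (d, q)) = gwTree x (consField (0, q)) := by
  have h1 : (gwTree x (consField (d, q))).children = (gwTree x (consField (0, q))).children := by
    funext u
    cases u <;> rfl
  have h2 : (gwTree x (consField (d, q))).label = (gwTree x (consField (0, q))).label := by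
    funext u
    cases u <;> rfl
  exact congrArg₂ LabeledTree.mk h1 h2

theorem measurable_increment {p : LabeledTree → Prop}
    (hp : ∀ z, Measurable fun g => p (gwTree z g)) (z : ℤ) :
    Measurable fun g : GWField => p (gwTree (z + (g []).2) g) := by
  have : (fun g : GWField => p (gwTree (z + (g []).2) g)) =
      fun g => ∃ d, (g []).2 = d ∧ p (gwTree (z + d) g) := by
    funext g
    simp
  rw [this]
  refine Measurable.exists fun d => Measurable.and ?_ (hp _)
  exact measurableSet_setOfPred.1
    ((measurable_snd.comp (measurable_pi_apply [])) (measurableSet_singleton d))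

/-- The field above a child holds the child's own increment at its root word. Reading it as the
displacement from the parent label `z`, independence turns the probability into an average over the
three possible labels. -/
theorem gwFieldLaw_increment {p : LabeledTree → Prop}
    (hp : ∀ z, Measurable fun g => p (gwTree z g)) (z : ℤ) :
    gwFieldLaw {g | p (gwTree (z + (g []).2) g)} =
      3⁻¹ * (gwFieldLaw {g | p (gwTree (z + -1) g)} + gwFieldLaw {g | p (gwTree (z + 0) g)} +
        gwFieldLaw {g | p (gwTree (z + 1) g)}) := by
  have hz (z : ℤ) : gwFieldLaw {g | p (gwTree z g)} =
      (offspringLaw.prod (Measure.infinitePi fun _ : ℕ => gwFieldLaw))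
        {q | p (gwTree z (consField (0, q)))} := by
    rw [← measurePreserving_consField.measure_preimage
      (measurableSet_setOfPred.2 (hp z)).nullMeasurableSet]
    have : consField ⁻¹' {g | p (gwTree z g)} =
        Set.univ ×ˢ {q | p (gwTree z (consField (0, q)))} := by
      ext ⟨d, q⟩
      simp only [Set.mem_preimage, Set.mem_ofPred_eq, Set.mem_prod, Set.mem_univ, true_and]
      rw [gwTree_consField]
    rw [this, Measure.prod_prod, measure_univ, one_mul]
  have hm := measurableSet_setOfPred.2 (measurable_increment hp z)
  rw [← measurePreserving_consField.measure_preimage hm.nullMeasurableSet,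
    Measure.prod_apply (measurePreserving_consField.measurable hm), hz, hz, hz,
    ← lintegral_stepLaw (fun d => (offspringLaw.prod (Measure.infinitePi fun _ : ℕ => gwFieldLaw))
        {q | p (gwTree (z + d) (consField (0, q)))})]
  refine lintegral_congr fun d => congrArg _ ?_
  ext q
  simp only [Set.mem_preimage, Set.mem_ofPred_eq]
  rw [gwTree_consField]
  rfl

theorem gwFieldLaw_children {S : Set (ℕ × (ℕ → GWField))} (hS : MeasurableSet S) :
    gwFieldLaw {g | ((g []).1, fun i v => g (i :: v)) ∈ S} =
      (offspringLaw.prod (Measure.infinitePi fun _ : ℕ => gwFieldLaw)) S := by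
  have hm : MeasurableSet {g : GWField | ((g []).1, fun (i : ℕ) v => g (i :: v)) ∈ S} := by
    have : Measurable fun g : GWField => ((g []).1, fun (i : ℕ) v => g (i :: v)) := by
      fun_prop
    exact this hS
  rw [← measurePreserving_consField.measure_preimage hm.nullMeasurableSet]
  have : consField ⁻¹' {g : GWField | ((g []).1, fun (i : ℕ) v => g (i :: v)) ∈ S} =
      Set.univ ×ˢ S := by
    ext ⟨d, q⟩
    simp [consField]
  rw [this, Measure.prod_prod, measure_univ, one_mul]

/-! ### Avoidance and hitting probabilities. -/

/-- The probability that a Galton--Watson tree with root label `y + x` avoids the label `y`. -/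
def avoidProb (y : ℤ) (x : ℕ) : ℝ≥0∞ :=
  gwFieldLaw {g | (gwTree (y + x) g).Avoids y}

/-- The probability of `HitsAlong` for a Galton--Watson tree with root label `y + x`. -/
def gwHitProb (y : ℤ) (C : ℕ → ℕ → Prop) (m x : ℕ) : ℝ≥0∞ :=
  gwFieldLaw {g | (gwTree (y + x) g).HitsAlong y C m}

/-- The probability of `HitsAlong` for the infinite tree with root label `y + x`. -/
def spineHitProb (y : ℤ) (C : ℕ → ℕ → Prop) (m x : ℕ) : ℝ≥0∞ :=
  sampleLaw {ω | (spineTree (y + x) ω).HitsAlong y C m}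

/-- The average of a function over a point and its two neighbours. -/
def avg (f : ℕ → ℝ≥0∞) (x : ℕ) : ℝ≥0∞ := 3⁻¹ * (f (x - 1) + f x + f (x + 1))

theorem avg_of_int (F : ℤ → ℝ≥0∞) (y : ℤ) {x : ℕ} (hx : x ≠ 0) :
    3⁻¹ * (F (y + x + -1) + F (y + x + 0) + F (y + x + 1)) = avg (fun a : ℕ => F (y + a)) x := by
  obtain ⟨n, rfl⟩ := Nat.exists_eq_succ_of_ne_zero hx
  simp only [avg, Nat.succ_eq_add_one, Nat.add_sub_cancel, add_zero]
  rw [show y + ((n + 1 : ℕ) : ℤ) + -1 = y + n by push_cast; ring,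
    show y + ((n + 1 : ℕ) : ℤ) + 1 = y + (n + 1 + 1 : ℕ) by push_cast; ring]

theorem measurable_gwTree_avoids (y z : ℤ) : Measurable fun g => (gwTree z g).Avoids y :=
  (measurableTree_gwTree (φ := id) measurable_id measurable_const).avoids y

theorem measurable_gwTree_hitsAlong (y : ℤ) (C : ℕ → ℕ → Prop) (m : ℕ) (z : ℤ) :
    Measurable fun g => (gwTree z g).HitsAlong y C m :=
  (measurableTree_gwTree (φ := id) measurable_id measurable_const).hitsAlong y C m

theorem measurable_spineTree_hitsAlong (y : ℤ) (C : ℕ → ℕ → Prop) (m : ℕ) (z : ℤ) :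
    Measurable fun ω => (spineTree z ω).HitsAlong y C m :=
  (measurableTree_spineTree (φ := id) measurable_id measurable_const).hitsAlong y C m

/-- The fields whose tree avoids `y`, for a parent with label `z`. -/
def avoidSet (y z : ℤ) : Set GWField := {g | (gwTree (z + (g []).2) g).Avoids y}

theorem measurableSet_avoidSet (y z : ℤ) : MeasurableSet (avoidSet y z) :=
  measurableSet_setOfPred.2 (measurable_increment (p := fun θ => θ.Avoids y) (measurable_gwTree_avoids y) z)

theorem gwFieldLaw_avoidSet (y : ℤ) {x : ℕ} (hx : x ≠ 0) :
    gwFieldLaw (avoidSet y (y + x)) = avg (avoidProb y) x := by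
  rw [avoidSet, gwFieldLaw_increment (p := fun θ => θ.Avoids y) (measurable_gwTree_avoids y)]
  exact avg_of_int (fun z => gwFieldLaw {g | (gwTree z g).Avoids y}) y hx

theorem avoidProb_zero (y : ℤ) : avoidProb y 0 = 0 := by
  have : {g | (gwTree (y + (0 : ℕ)) g).Avoids y} = ∅ := by
    ext g
    simp only [Set.mem_ofPred_eq, Set.mem_empty_iff_false, iff_false]
    intro h
    exact h [] (LabeledTree.isVertex_nil _) (by simp [gwTree, gwLabel])
  rw [avoidProb, this, measure_empty]

theorem avoidProb_le_one (y : ℤ) (x : ℕ) : avoidProb y x ≤ 1 := prob_le_one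

/-- Condition on the number `n` of children of the root: their subtrees avoid `y` independently. -/
theorem avoidProb_eq (y : ℤ) {x : ℕ} (hx : x ≠ 0) :
    avoidProb y x = ∑' n : ℕ, 2⁻¹ ^ (n + 1) * avg (avoidProb y) x ^ n := by
  set Av := avoidSet y (y + x) with hAv
  have hAvm : MeasurableSet Av := measurableSet_avoidSet _ _
  have hsec (n : ℕ) : (Measure.infinitePi fun _ : ℕ => gwFieldLaw)
      {h | ∀ i < n, h i ∈ Av} = avg (avoidProb y) x ^ n := by
    have : {h : ℕ → GWField | ∀ i < n, h i ∈ Av} =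
        Set.pi (Finset.range n : Finset ℕ) (fun _ => Av) := by
      ext h; simp [Set.mem_pi]
    rw [this, Measure.infinitePi_pi _ (fun _ _ => hAvm), Finset.prod_const, Finset.card_range,
      gwFieldLaw_avoidSet y hx]
  have hS : MeasurableSet {q : ℕ × (ℕ → GWField) | ∀ i < q.1, q.2 i ∈ Av} := by
    refine measurableSet_setOfPred.2 (Measurable.forall fun i => Measurable.imp ?_ ?_)
    · exact measurableSet_setOfPred.1 (measurableSet_lt measurable_const measurable_fst)
    · exact measurableSet_setOfPred.1
        (((measurable_pi_apply i).comp measurable_snd) hAvm)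
  have h := gwFieldLaw_children hS
  rw [Measure.prod_apply hS, lintegral_countable'] at h
  have hset : {g | (gwTree (y + x) g).Avoids y} =
      {g : GWField | ((g []).1, fun (i : ℕ) v => g (i :: v)) ∈
        {q : ℕ × (ℕ → GWField) | ∀ i < q.1, q.2 i ∈ Av}} := by
    ext g
    simp only [Set.mem_ofPred_eq]
    rw [LabeledTree.avoids_iff]
    have : (gwTree (y + x) g).label [] ≠ y := by
      simp [gwTree, gwLabel, hx]
    exact and_iff_right this
  rw [avoidProb, hset, h]
  refine tsum_congr fun n => ?_
  rw [offspringLaw_singleton, mul_comm, ← hsec n]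
  rfl

theorem le_gwHitProb_zero (y : ℤ) {C : ℕ → ℕ → Prop} (hC : C 0 0) :
    1 ≤ gwHitProb y C 0 0 := by
  have : {g | (gwTree (y + (0 : ℕ)) g).HitsAlong y C 0} = Set.univ := by
    ext g
    simp only [Set.mem_ofPred_eq, Set.mem_univ, iff_true]
    exact LabeledTree.hitsAlong_zero (by simp [gwTree, gwLabel]) hC
  rw [gwHitProb, this, measure_univ]

theorem le_spineHitProb_zero (y : ℤ) {C : ℕ → ℕ → Prop} (hC : C 0 0) :
    1 ≤ spineHitProb y C 0 0 := by
  have : {ω | (spineTree (y + (0 : ℕ)) ω).HitsAlong y C 0} = Set.univ := by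
    ext g
    simp only [Set.mem_ofPred_eq, Set.mem_univ, iff_true]
    exact LabeledTree.hitsAlong_zero (by simp [spineTree_label_nil]) hC
  rw [spineHitProb, this, measure_univ]

/-- Passing through child `i` costs `P(N > i)`, `i` avoidances and one hit. As `P(N > i) = P(N =
i)`, the sum over `i` of the first two factors is the series of `avoidProb_eq`. -/
theorem le_gwHitProb_succ (y : ℤ) {C : ℕ → ℕ → Prop} {m x : ℕ} (hx : x ≠ 0) (hC : C (m + 1) x) :
    avoidProb y x * avg (gwHitProb y C m) x ≤ gwHitProb y C (m + 1) x := by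
  classical
  set Av := avoidSet y (y + x) with hAv
  have hAvm : MeasurableSet Av := measurableSet_avoidSet _ _
  set H : Set GWField := {g | (gwTree (y + x + (g []).2) g).HitsAlong y C m} with hH
  have hHm : MeasurableSet H :=
    measurableSet_setOfPred.2 (measurable_increment (p := fun θ => θ.HitsAlong y C m)
      (measurable_gwTree_hitsAlong y C m) _)
  have hHl : gwFieldLaw H = avg (gwHitProb y C m) x := by
    rw [hH, gwFieldLaw_increment (p := fun θ => θ.HitsAlong y C m)
      (measurable_gwTree_hitsAlong y C m)]
    exact avg_of_int (fun z => gwFieldLaw {g | (gwTree z g).HitsAlong y C m}) y hx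
  let t : ℕ → ℕ → Set GWField := fun i j => if j = i then H else Av
  have htm (i j : ℕ) : MeasurableSet (t i j) := by
    simp only [t]; split_ifs <;> assumption
  let P : ℕ → Set (ℕ → GWField) := fun i => Set.pi (Finset.range (i + 1) : Finset ℕ) (t i)
  have hPm (i : ℕ) : MeasurableSet (P i) :=
    MeasurableSet.pi (Finset.countable_toSet _) fun j _ => htm i j
  have hPl (i : ℕ) : (Measure.infinitePi fun _ : ℕ => gwFieldLaw) (P i) =
      avg (avoidProb y) x ^ i * avg (gwHitProb y C m) x := by
    rw [Measure.infinitePi_pi _ (fun j _ => htm i j), Finset.prod_range_succ]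
    simp only [t, if_true]
    rw [hHl, Finset.prod_congr rfl (g := fun _ => avg (avoidProb y) x), Finset.prod_const,
      Finset.card_range]
    intro j hj
    rw [if_neg (Finset.mem_range.1 hj).ne, gwFieldLaw_avoidSet y hx]
  have hmem (i : ℕ) (h : ℕ → GWField) : h ∈ P i ↔ (∀ j < i, h j ∈ Av) ∧ h i ∈ H := by
    simp only [P, t, Set.mem_pi, Finset.coe_range, Set.mem_Iio]
    constructor
    · intro hh
      exact ⟨fun j hj => by simpa [hj.ne] using hh j (by omega), by simpa using hh i (by omega)⟩
    · rintro ⟨h1, h2⟩ j hj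
      rcases Nat.lt_succ_iff_lt_or_eq.1 hj with hj | rfl
      · rw [if_neg hj.ne]; exact h1 j hj
      · rwa [if_pos rfl]
  let S : Set (ℕ × (ℕ → GWField)) := ⋃ i, Set.Ioi i ×ˢ P i
  have hSm : MeasurableSet S := MeasurableSet.iUnion fun i => measurableSet_Ioi.prod (hPm i)
  -- For `i < j`, the subtree of child `i` would have both to hit and to avoid `y`.
  have hdisj : Pairwise (Function.onFun Disjoint fun i => Set.Ioi i ×ˢ P i) := by
    suffices h : ∀ i j, i < j → Disjoint (Set.Ioi i ×ˢ P i) (Set.Ioi j ×ˢ P j) by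
      intro i j hij
      rcases hij.lt_or_gt with hij | hij
      · exact h i j hij
      · exact (h j i hij).symm
    intro i j hij
    rw [Set.disjoint_left]
    rintro ⟨n, h⟩ ⟨-, h1⟩ ⟨-, h2⟩
    have h3 : h i ∈ H := ((hmem i h).1 h1).2
    have h4 : h i ∈ Av := ((hmem j h).1 h2).1 i hij
    exact h3.not_avoids h4
  have hSl : (offspringLaw.prod (Measure.infinitePi fun _ : ℕ => gwFieldLaw)) S =
      avoidProb y x * avg (gwHitProb y C m) x := by
    rw [measure_iUnion hdisj (fun i => measurableSet_Ioi.prod (hPm i)), avoidProb_eq y hx,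
      ← ENNReal.tsum_mul_right]
    refine tsum_congr fun i => ?_
    rw [Measure.prod_prod, offspringLaw_Ioi, hPl, mul_assoc]
  rw [← hSl, ← gwFieldLaw_children hSm]
  refine measure_mono fun g hg => ?_
  obtain ⟨i, hi, hP⟩ := Set.mem_iUnion.1 hg
  obtain ⟨h1, h2⟩ := (hmem i _).1 hP
  exact LabeledTree.hitsAlong_cons (i := i) rfl hx hC hi h1 h2

/-- Fubini for the spine step: `α` carries the spine increment, `β` the left tree, `γ` the later
sample; the right tree in `β'` is integrated out. -/
theorem measure_prod_inter {α β β' γ : Type*} [MeasurableSpace α] [MeasurableSpace β]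
    [MeasurableSpace β'] [MeasurableSpace γ] [DiscreteMeasurableSpace α] (μ : Measure α)
    (ν : Measure β) (ν' : Measure β') (ρ : Measure γ) [SFinite μ] [SFinite ν]
    [IsProbabilityMeasure ν'] [SFinite ρ] {A : Set β} (hA : MeasurableSet A) (K : α → Set γ)
    (hS : MeasurableSet {p : (α × β × β') × γ | p.1.2.1 ∈ A ∧ p.2 ∈ K p.1.1}) :
    ((μ.prod (ν.prod ν')).prod ρ) {p : (α × β × β') × γ | p.1.2.1 ∈ A ∧ p.2 ∈ K p.1.1} =
      ν A * ∫⁻ d, ρ (K d) ∂μ := by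
  obtain ⟨φ, hφ⟩ : ∃ φ : β → ℝ≥0∞, φ = A.indicator 1 := ⟨_, rfl⟩
  have hsec (a : α × β × β') : ρ (Prod.mk a ⁻¹'
      {p : (α × β × β') × γ | p.1.2.1 ∈ A ∧ p.2 ∈ K p.1.1}) = ρ (K a.1) * φ a.2.1 := by
    by_cases ha : a.2.1 ∈ A
    · simp [Set.preimage, ha, hφ]
    · simp [Set.preimage, ha, hφ]
  have hm1 : Measurable φ := hφ ▸ measurable_one.indicator hA
  have hm2 : Measurable fun d => ρ (K d) := Measurable.of_discrete
  have hm3 : Measurable fun a : α × β × β' => ρ (K a.1) * φ a.2.1 :=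
    (hm2.comp measurable_fst).mul (hm1.comp (measurable_fst.comp measurable_snd))
  have hm4 : Measurable fun b : β × β' => φ b.1 := hm1.comp measurable_fst
  rw [Measure.prod_apply hS]
  simp only [hsec]
  rw [lintegral_prod _ hm3.aemeasurable, mul_comm, ← lintegral_mul_const _ hm2]
  refine lintegral_congr fun d => ?_
  change ∫⁻ a : β × β', ρ (K d) * φ a.1 ∂(ν.prod ν') = _
  rw [lintegral_const_mul _ hm4, lintegral_prod _ hm4.aemeasurable]
  simp only [lintegral_const, measure_univ, mul_one]
  rw [hφ, lintegral_indicator_one hA]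

/-- Two disjoint scenarios: the hit occurs in the first left tree, or that tree avoids `y` and the
branch follows the spine for one more edge. -/
theorem le_spineHitProb_succ (y : ℤ) {C : ℕ → ℕ → Prop} {m x : ℕ} (hx : x ≠ 0)
    (hC : C (m + 1) x) :
    gwHitProb y C (m + 1) x + avoidProb y x * avg (spineHitProb y C m) x ≤
      spineHitProb y C (m + 1) x := by
  set H : Set GWField := {g | (gwTree (y + x) g).HitsAlong y C (m + 1)} with hH
  set Av : Set GWField := {g | (gwTree (y + x) g).Avoids y} with hAv
  have hHm : MeasurableSet H := measurableSet_setOfPred.2 (measurable_gwTree_hitsAlong y C _ _)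
  have hAvm : MeasurableSet Av := measurableSet_setOfPred.2 (measurable_gwTree_avoids y _)
  let S₁ : Set ((ℤ × GWField × GWField) × Sample) :=
    (Set.univ ×ˢ (H ×ˢ Set.univ)) ×ˢ Set.univ
  let S₂ : Set ((ℤ × GWField × GWField) × Sample) :=
    {p | p.1.2.1 ∈ Av ∧ (spineTree (y + x + p.1.1) p.2).HitsAlong y C m}
  have hS₁ : MeasurableSet S₁ :=
    (MeasurableSet.univ.prod (hHm.prod MeasurableSet.univ)).prod MeasurableSet.univ
  have hS₂ : MeasurableSet S₂ := by
    refine measurableSet_setOfPred.2 (Measurable.and ?_ ?_)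
    · exact measurableSet_setOfPred.1
        ((measurable_fst.comp (measurable_snd.comp measurable_fst)) hAvm)
    · exact (measurableTree_spineTree measurable_snd
        ((measurable_fst.comp measurable_fst).const_add _)).hitsAlong y C m
  have hdisj : Disjoint S₁ S₂ := by
    rw [Set.disjoint_left]
    rintro p ⟨⟨-, h1, -⟩, -⟩ ⟨h2, -⟩
    have h1' : p.1.2.1 ∈ H := h1
    exact h1'.not_avoids h2
  have hl₁ : ((stepLaw.prod (gwFieldLaw.prod gwFieldLaw)).prod sampleLaw) S₁ =
      gwHitProb y C (m + 1) x := by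
    simp only [S₁, Measure.prod_prod, measure_univ, one_mul, mul_one]
    rfl
  have hl₂ : ((stepLaw.prod (gwFieldLaw.prod gwFieldLaw)).prod sampleLaw) S₂ =
      avoidProb y x * avg (spineHitProb y C m) x := by
    have e : avg (spineHitProb y C m) x =
        avg (fun a : ℕ => sampleLaw {ω | (spineTree (y + a) ω).HitsAlong y C m}) x := rfl
    rw [e, ← avg_of_int (fun z => sampleLaw {ω | (spineTree z ω).HitsAlong y C m}) y hx,
      ← lintegral_stepLaw (fun d => sampleLaw {ω | (spineTree (y + x + d) ω).HitsAlong y C m})]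
    exact measure_prod_inter stepLaw gwFieldLaw gwFieldLaw sampleLaw hAvm
      (fun d : ℤ => {ω | (spineTree (y + x + d) ω).HitsAlong y C m}) hS₂
  rw [← hl₁, ← hl₂, ← measure_union hdisj hS₂, spineHitProb,
    ← measurePreserving_consSample.measure_preimage
      (measurableSet_setOfPred.2 (measurable_spineTree_hitsAlong y C _ _)).nullMeasurableSet]
  refine measure_mono fun p hp => ?_
  rcases hp with ⟨⟨-, h1, -⟩, -⟩ | ⟨h1, h2⟩
  · refine spineTree_hitsAlong_left ?_ h1
    simpa using hx
  · exact spineTree_hitsAlong_spine (ω := consSample p) hx hC h1 h2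

/-! ### The avoidance probability -/

/-- Where `d ≥ 0` the recursion makes `d` convex. If `d 1 > 0`, the increments never fall below `d
1`, and `d` grows linearly. -/
theorem convex_bounded_nonpos {d c : ℕ → ℝ} {M : ℝ} (h0 : d 0 = 0) (hc : ∀ x, 0 ≤ c x)
    (hrec : ∀ x, d (x + 2) = 2 * d (x + 1) - d x + c x * d (x + 1)) (hb : ∀ x, d x ≤ M) :
    d 1 ≤ 0 := by
  by_contra! h1
  have key : ∀ x, 0 ≤ d x ∧ d x + d 1 ≤ d (x + 1) := by
    intro x
    induction x with
    | zero => simp [h0]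
    | succ x ih =>
      have h2 : 0 ≤ d (x + 1) := by linarith [ih.1, ih.2]
      refine ⟨h2, ?_⟩
      have h3 := mul_nonneg (hc x) h2
      have h4 : d (x + 1 + 1) = 2 * d (x + 1) - d x + c x * d (x + 1) := hrec x
      linarith [ih.2]
  have lin : ∀ x : ℕ, x * d 1 ≤ d x := by
    intro x
    induction x with
    | zero => simp [h0]
    | succ x ih =>
      push_cast
      linarith [(key x).2]
  obtain ⟨n, hn⟩ := exists_nat_gt (M / d 1)
  rw [div_lt_iff₀ h1] at hn
  linarith [lin n, hb n]

theorem convex_bounded_eq_zero {d c : ℕ → ℝ} {M : ℝ} (h0 : d 0 = 0) (hc : ∀ x, 0 ≤ c x)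
    (hrec : ∀ x, d (x + 2) = 2 * d (x + 1) - d x + c x * d (x + 1)) (hb : ∀ x, |d x| ≤ M) (x : ℕ) :
    d x = 0 := by
  have h1 := convex_bounded_nonpos h0 hc hrec (fun x => (abs_le.1 (hb x)).2)
  have h2 := convex_bounded_nonpos (d := fun x => - d x) (M := M) (by simp [h0]) hc
    (fun x => by simp only [hrec]; ring) (fun x => by linarith [(abs_le.1 (hb x)).1])
  have h3 : d 1 = 0 := by linarith
  suffices h : ∀ x, d x = 0 ∧ d (x + 1) = 0 from (h x).1
  intro x
  induction x with
  | zero => exact ⟨h0, h3⟩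
  | succ x ih => exact ⟨ih.2, by rw [hrec x, ih.1, ih.2]; ring⟩

/-- The probability that all labels are positive when the root has label `x`. -/
def survival (x : ℕ) : ℝ := x * (x + 3) / ((x + 1) * (x + 2))

theorem survival_nonneg (x : ℕ) : 0 ≤ survival x := by unfold survival; positivity

theorem survival_pos (x : ℕ) : 0 < survival (x + 1) := by
  unfold survival; push_cast; positivity

theorem survival_le_one (x : ℕ) : survival x ≤ 1 := by
  unfold survival
  rw [div_le_one (by positivity)]
  nlinarith

/-- Both functions solve the same nonlinear recursion; their difference solves a linear one to which
`convex_bounded_eq_zero` applies. -/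
theorem eq_survival {W : ℕ → ℝ} (h0 : W 0 = 0) (hW : ∀ x, 0 ≤ W x) (hW1 : ∀ x, W x ≤ 1)
    (hrec : ∀ x, W (x + 1) * (2 - (W x + W (x + 1) + W (x + 2)) / 3) = 1) (x : ℕ) :
    W x = survival x := by
  have hpos (x : ℕ) : 0 < W (x + 1) := by
    rcases (hW (x + 1)).lt_or_eq with h | h
    · exact h
    · have := hrec x
      rw [← h, zero_mul] at this
      norm_num at this
  have hnext (x : ℕ) : W (x + 2) = 6 - 3 / W (x + 1) - W x - W (x + 1) := by
    have h1 := hrec x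
    have h2 := (hpos x).ne'
    field_simp
    nlinarith [h1]
  have snext (x : ℕ) :
      survival (x + 2) = 6 - 3 / survival (x + 1) - survival x - survival (x + 1) := by
    unfold survival
    push_cast
    field_simp
    ring
  have := convex_bounded_eq_zero (d := fun x => W x - survival x) (M := 1)
    -- The difference of the terms `-3 / W` and `-3 / survival` is `3 / (W * survival)` times the
    -- difference of the functions; `c ≥ 0` because both are at most `1`.
    (c := fun x => 3 * (1 / (W (x + 1) * survival (x + 1)) - 1)) (by simp [h0, survival])
    (fun x => by
      have h1 : 1 ≤ 1 / (W (x + 1) * survival (x + 1)) := by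
        rw [le_div_iff₀ (mul_pos (hpos x) (survival_pos x)), one_mul]
        exact mul_le_one₀ (hW1 _) (survival_nonneg _) (survival_le_one _)
      linarith)
    (fun x => by
      have h1 := (hpos x).ne'
      have h2 := (survival_pos x).ne'
      simp only [hnext x, snext x]
      field_simp
      ring)
    (fun x => abs_le.2 ⟨by linarith [hW x, survival_le_one x],
      by linarith [hW1 x, survival_nonneg x]⟩) x
  linarith [this]

/-- The geometric series in `avoidProb_eq` sums to `1 / (2 - m)`, with `m` the average over the
neighbours. -/
theorem avoidProb_toReal_rec (y : ℤ) (x : ℕ) :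
    (avoidProb y (x + 1)).toReal * (2 - ((avoidProb y x).toReal + (avoidProb y (x + 1)).toReal +
      (avoidProb y (x + 2)).toReal) / 3) = 1 := by
  have hfin (x : ℕ) : avoidProb y x ≠ ∞ := ne_top_of_le_ne_top ENNReal.one_ne_top
    (avoidProb_le_one y x)
  have hle (x : ℕ) : (avoidProb y x).toReal ≤ 1 :=
    ENNReal.toReal_le_of_le_ofReal zero_le_one (by simpa using avoidProb_le_one y x)
  set m := avg (avoidProb y) (x + 1) with hm
  have hmr : m.toReal = ((avoidProb y x).toReal + (avoidProb y (x + 1)).toReal +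
      (avoidProb y (x + 2)).toReal) / 3 := by
    rw [hm, avg, ENNReal.toReal_mul, ENNReal.toReal_add (by simp [hfin]) (hfin _),
      ENNReal.toReal_add (by simp [hfin]) (hfin _)]
    simp only [ENNReal.toReal_inv, ENNReal.toReal_ofNat, Nat.add_sub_cancel]
    ring
  have hm1 : m.toReal ≤ 1 := by rw [hmr]; linarith [hle x, hle (x + 1), hle (x + 2)]
  have h := avoidProb_eq y (Nat.succ_ne_zero x)
  have h2 : ∑' n : ℕ, 2⁻¹ ^ (n + 1) * m ^ n = 2⁻¹ * (1 - 2⁻¹ * m)⁻¹ := by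
    rw [← ENNReal.tsum_geometric, ← ENNReal.tsum_mul_left]
    refine tsum_congr fun n => ?_
    rw [mul_pow, pow_succ]
    ring
  have hmt : m ≠ ∞ := by
    rw [hm, avg]
    exact ENNReal.mul_ne_top (by simp) (by simp [hfin])
  have hmle : m ≤ 1 := by
    rw [← ENNReal.ofReal_toReal hmt]
    exact ENNReal.ofReal_le_one.2 hm1
  have hle1 : 2⁻¹ * m ≤ 1 := mul_le_one' (by simp) hmle
  rw [Nat.succ_eq_add_one, ← hm, h2] at h
  rw [← hmr, h, ENNReal.toReal_mul, ENNReal.toReal_inv, ENNReal.toReal_inv,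
    ENNReal.toReal_sub_of_le hle1 ENNReal.one_ne_top, ENNReal.toReal_mul, ENNReal.toReal_inv]
  simp only [ENNReal.toReal_ofNat, ENNReal.toReal_one]
  have : (1 - 2⁻¹ * m.toReal) ≠ 0 := by
    intro h; linarith
  field_simp
  rw [div_self]
  intro h; linarith

theorem avoidProb_eq_survival (y : ℤ) (x : ℕ) :
    avoidProb y x = ENNReal.ofReal (survival x) := by
  have hfin (x : ℕ) : avoidProb y x ≠ ∞ := ne_top_of_le_ne_top ENNReal.one_ne_top
    (avoidProb_le_one y x)
  rw [← eq_survival (W := fun x => (avoidProb y x).toReal) (by simp [avoidProb_zero])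
    (fun x => ENNReal.toReal_nonneg) (fun x => ENNReal.toReal_le_of_le_ofReal zero_le_one
      (by simpa using avoidProb_le_one y x)) (avoidProb_toReal_rec y) x,
    ENNReal.ofReal_toReal (hfin x)]

theorem homogeneous_bounded_eq_zero {δ : ℕ → ℝ} {M : ℝ} (h0 : δ 0 = 0) (hb : ∀ x, |δ x| ≤ M)
    (hrec : ∀ x, δ (x + 1) = survival (x + 1) * ((δ x + δ (x + 1) + δ (x + 2)) / 3)) (x : ℕ) :
    δ x = 0 := by
  refine convex_bounded_eq_zero (c := fun x => 3 / survival (x + 1) - 3) h0 (fun x => ?_)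
    (fun x => ?_) hb x
  · have : 3 ≤ 3 / survival (x + 1) := by
      rw [le_div_iff₀ (survival_pos x)]
      linarith [survival_le_one (x + 1)]
    linarith
  · have h := hrec x
    have h1 := (survival_pos x).ne'
    field_simp at h ⊢
    linarith

/-! ### The transfer operator -/

/-- A step of the path from a vertex towards the first vertex with a given label. -/
def transfer : (ℕ → ℝ≥0∞) →ₗ[ℝ≥0∞] (ℕ → ℝ≥0∞) where
  toFun f x := ENNReal.ofReal (survival x) * avg f x
  map_add' f g := by
    funext x
    simp only [avg, Pi.add_apply]
    ring
  map_smul' c f := by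
    funext x
    simp only [avg, Pi.smul_apply, smul_eq_mul, RingHom.id_apply]
    ring

theorem transfer_apply (f : ℕ → ℝ≥0∞) (x : ℕ) :
    transfer f x = ENNReal.ofReal (survival x) * avg f x := rfl

/-- The state `0` is a dead end, so the truncated `0 - 1` inside `avg` is harmless. -/
theorem transfer_apply_zero (f : ℕ → ℝ≥0∞) : transfer f 0 = 0 := by
  simp [transfer_apply, survival]

/-- The weight of a step from a vertex with shifted label `x`. -/
def stepWeight (x : ℕ) : ℝ := survival x / 3

theorem stepWeight_nonneg (x : ℕ) : 0 ≤ stepWeight x := div_nonneg (survival_nonneg x) (by norm_num)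

theorem stepWeight_pos (x : ℕ) : 0 < stepWeight (x + 1) := div_pos (survival_pos x) (by norm_num)

theorem transfer_apply' (f : ℕ → ℝ≥0∞) (x : ℕ) :
    transfer f x = ENNReal.ofReal (stepWeight x) * (f (x - 1) + f x + f (x + 1)) := by
  rw [transfer_apply, avg, stepWeight, div_eq_mul_inv, ENNReal.ofReal_mul (survival_nonneg x),
    ENNReal.ofReal_inv_of_pos (by norm_num), mul_assoc]
  norm_num

theorem transfer_single_zero :
    transfer (Pi.single 0 1) = ENNReal.ofReal (stepWeight 1) • (Pi.single 1 1 : ℕ → ℝ≥0∞) := by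
  funext x
  rw [transfer_apply']
  rcases x with _ | _ | x
  · simp [stepWeight, survival]
  · simp
  · simp

theorem transfer_single_succ (y : ℕ) :
    transfer (Pi.single (y + 1) 1) = ENNReal.ofReal (stepWeight y) • (Pi.single y 1 : ℕ → ℝ≥0∞) +
      ENNReal.ofReal (stepWeight (y + 1)) • (Pi.single (y + 1) 1 : ℕ → ℝ≥0∞) +
      ENNReal.ofReal (stepWeight (y + 2)) • (Pi.single (y + 2) 1 : ℕ → ℝ≥0∞) := by
  funext x
  rw [transfer_apply']
  simp only [Pi.add_apply, Pi.smul_apply, smul_eq_mul, Pi.single_apply]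
  rcases Nat.eq_zero_or_pos x with rfl | hx
  · simp [stepWeight, survival]
    rintro rfl
    norm_num
  · by_cases h1 : x = y
    · subst h1
      have : x - 1 ≠ x + 1 := by omega
      simp [this]
    · by_cases h2 : x = y + 1
      · subst h2; simp
      · by_cases h3 : x = y + 2
        · subst h3; simp
        · have : x - 1 ≠ y + 1 := by omega
          simp [this, h1, h2, h3]

theorem transfer_mono {f g : ℕ → ℝ≥0∞} (h : f ≤ g) : transfer f ≤ transfer g := by
  intro x
  rw [transfer_apply', transfer_apply']
  gcongr <;> exact h _

theorem transfer_tsum (f : ℕ → ℕ → ℝ≥0∞) (x : ℕ) :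
    transfer (fun a => ∑' n, f n a) x = ∑' n, transfer (f n) x := by
  simp only [transfer_apply', ENNReal.tsum_mul_left, ENNReal.tsum_add]

/-! ### Green functions and their one-step equations. -/

/-- The Green function of the transfer operator. -/
def green (k y : ℕ) : ℝ≥0∞ := ∑' n : ℕ, (transfer ^ n) (Pi.single y 1) k

/-- The Green function with paths counted with multiplicity their number of vertices. -/
def green₂ (k y : ℕ) : ℝ≥0∞ := ∑' n : ℕ, ((n : ℝ≥0∞) + 1) * (transfer ^ n) (Pi.single y 1) k

theorem tsum_succ_mul (g : ℕ → ℝ≥0∞) : ∑' n : ℕ, ((n : ℝ≥0∞) + 1) * g n =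
    ∑' n, g n + ∑' n : ℕ, ((n : ℝ≥0∞) + 1) * g (n + 1) := by
  rw [tsum_eq_zero_add' ENNReal.summable, tsum_eq_zero_add' (f := g) ENNReal.summable, add_assoc,
    ← ENNReal.tsum_add]
  congr 1
  · simp
  · refine tsum_congr fun n => ?_
    push_cast
    ring

theorem transfer_pow_succ (n y k : ℕ) : (transfer ^ (n + 1)) (Pi.single y 1) k =
    (transfer ^ n) (transfer (Pi.single y 1)) k := by
  rw [pow_succ, Module.End.mul_apply]

/-- Removing the step at the end `y` gives recursions in `y` for fixed `k`; removing the step at the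
start, as in `green_left`, gives equations in `k`, to which the uniqueness principle applies. -/
theorem green_zero_right (k : ℕ) : green k 0 = (Pi.single 0 1 : ℕ → ℝ≥0∞) k +
    ENNReal.ofReal (stepWeight 1) * green k 1 := by
  rw [green, tsum_eq_zero_add' ENNReal.summable, green, ← ENNReal.tsum_mul_left]
  congr 1
  refine tsum_congr fun n => ?_
  rw [transfer_pow_succ, transfer_single_zero, map_smul]
  rfl

theorem green_succ_right (k y : ℕ) : green k (y + 1) = (Pi.single (y + 1) 1 : ℕ → ℝ≥0∞) k +
    (ENNReal.ofReal (stepWeight y) * green k y +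
      ENNReal.ofReal (stepWeight (y + 1)) * green k (y + 1) +
      ENNReal.ofReal (stepWeight (y + 2)) * green k (y + 2)) := by
  conv_lhs => rw [green, tsum_eq_zero_add' ENNReal.summable]
  congr 1
  simp only [green, ← ENNReal.tsum_mul_left, ← ENNReal.tsum_add]
  refine tsum_congr fun n => ?_
  rw [transfer_pow_succ, transfer_single_succ, map_add, map_add, map_smul, map_smul, map_smul]
  rfl

theorem green₂_zero_right (k : ℕ) : green₂ k 0 = green k 0 +
    ENNReal.ofReal (stepWeight 1) * green₂ k 1 := by
  rw [green₂, tsum_succ_mul, green₂, ← ENNReal.tsum_mul_left]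
  congr 1
  refine tsum_congr fun n => ?_
  rw [transfer_pow_succ, transfer_single_zero, map_smul, Pi.smul_apply, smul_eq_mul]
  ring

theorem green₂_succ_right (k y : ℕ) : green₂ k (y + 1) = green k (y + 1) +
    (ENNReal.ofReal (stepWeight y) * green₂ k y +
      ENNReal.ofReal (stepWeight (y + 1)) * green₂ k (y + 1) +
      ENNReal.ofReal (stepWeight (y + 2)) * green₂ k (y + 2)) := by
  conv_lhs => rw [green₂, tsum_succ_mul]
  congr 1
  simp only [green₂, ← ENNReal.tsum_mul_left, ← ENNReal.tsum_add]
  refine tsum_congr fun n => ?_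
  rw [transfer_pow_succ, transfer_single_succ, map_add, map_add, map_smul, map_smul, map_smul]
  simp only [Pi.add_apply, Pi.smul_apply, smul_eq_mul]
  ring

theorem green_left (k y : ℕ) : green k y = (Pi.single y 1 : ℕ → ℝ≥0∞) k +
    transfer (fun a => green a y) k := by
  simp only [green]
  rw [tsum_eq_zero_add' ENNReal.summable, transfer_tsum]
  congr 1
  refine tsum_congr fun n => ?_
  rw [pow_succ', Module.End.mul_apply]

theorem green₂_left (k y : ℕ) : green₂ k y = green k y + transfer (fun a => green₂ a y) k := by
  simp only [green₂]
  rw [tsum_succ_mul, transfer_tsum]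
  congr 1
  refine tsum_congr fun n => ?_
  rw [pow_succ', Module.End.mul_apply]
  exact congrFun (transfer.map_smul ((n : ℝ≥0∞) + 1) ((transfer ^ n) (Pi.single y 1))).symm k

theorem green_le_green₂ (k y : ℕ) : green k y ≤ green₂ k y :=
  ENNReal.tsum_le_tsum fun _ => le_mul_of_one_le_left' le_add_self

/-! ### Lower bounds for the hitting probabilities -/

open Classical in
/-- The weight of the paths with shifted labels from `x` to `0` in `m` steps that satisfy the
constraint `C`. -/
def pathWeight (C : ℕ → ℕ → Prop) : ℕ → ℕ → ℝ≥0∞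
  | 0 => Pi.single 0 1
  | m + 1 => fun x => if C (m + 1) x then transfer (pathWeight C m) x else 0

open Classical in
theorem pathWeight_succ (C : ℕ → ℕ → Prop) (m x : ℕ) : pathWeight C (m + 1) x =
    if C (m + 1) x then transfer (pathWeight C m) x else 0 := rfl

theorem pathWeight_le_gwHitProb (y : ℤ) {C : ℕ → ℕ → Prop} (hC : C 0 0) (m : ℕ) :
    pathWeight C m ≤ gwHitProb y C m := by
  induction m with
  | zero =>
    intro x
    rcases Nat.eq_zero_or_pos x with rfl | hx
    · simpa [pathWeight] using le_gwHitProb_zero y hC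
    · simp [pathWeight, Pi.single_eq_of_ne hx.ne']
  | succ m ih =>
    intro x
    rw [pathWeight_succ]
    split_ifs with h
    · rcases Nat.eq_zero_or_pos x with rfl | hx
      · rw [transfer_apply_zero]; exact zero_le
      · refine (transfer_mono ih x).trans ?_
        rw [transfer_apply, ← avoidProb_eq_survival y]
        exact le_gwHitProb_succ y hx.ne' h
    · exact zero_le

/-- The factor counts the `m + 1` vertices of the branch at which it may leave the spine, each
choice having the same weight. -/
theorem pathWeight_le_spineHitProb (y : ℤ) {C : ℕ → ℕ → Prop} (hC : C 0 0) (m : ℕ) :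
    ((m : ℝ≥0∞) + 1) • pathWeight C m ≤ spineHitProb y C m := by
  induction m with
  | zero =>
    intro x
    rcases Nat.eq_zero_or_pos x with rfl | hx
    · simpa [pathWeight] using le_spineHitProb_zero y hC
    · simp [pathWeight, Pi.single_eq_of_ne hx.ne']
  | succ m ih =>
    intro x
    rw [Pi.smul_apply, smul_eq_mul]
    by_cases h : C (m + 1) x
    · rcases Nat.eq_zero_or_pos x with rfl | hx
      · simp [pathWeight, transfer_apply_zero]
      · refine le_trans ?_ (le_spineHitProb_succ y hx.ne' h)
        have h1 := pathWeight_le_gwHitProb y hC (m + 1) x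
        have h2 := transfer_mono ih x
        rw [map_smul, transfer_apply _ x, ← avoidProb_eq_survival y] at h2
        rw [Nat.cast_add, add_comm, add_mul]
        refine add_le_add ?_ ?_
        · simpa using h1
        · refine le_trans (le_of_eq ?_) h2
          simp [pathWeight, h]
    · simp [pathWeight, h]

/-- The first hit has only one height, so the events for different heights are disjoint. -/
theorem tsum_pathWeight_le (y : ℤ) {C : ℕ → ℕ → Prop} (hC : C 0 0) (x r : ℕ) :
    ∑' n : ℕ, (((n + r : ℕ) : ℝ≥0∞) + 1) * pathWeight C (n + r) x ≤
      sampleLaw {ω | ∃ m, r ≤ m ∧ (spineTree (y + x) ω).HitsAlong y C m} := by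
  have hm (m : ℕ) : MeasurableSet {ω | (spineTree (y + x) ω).HitsAlong y C m} :=
    measurableSet_setOfPred.2 (measurable_spineTree_hitsAlong y C m _)
  have hdisj : Pairwise (Function.onFun Disjoint
      fun n : ℕ => {ω | (spineTree (y + x) ω).HitsAlong y C (n + r)}) := by
    intro a b hab
    refine Set.disjoint_left.2 fun ω h1 h2 => hab ?_
    have := LabeledTree.HitsAlong.height_unique h1 h2
    omega
  refine (ENNReal.tsum_le_tsum fun n => pathWeight_le_spineHitProb y hC (n + r) x).trans ?_
  unfold spineHitProb
  rw [← measure_iUnion hdisj fun n => hm _]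
  refine measure_mono fun ω hω => ?_
  obtain ⟨n, hn⟩ := Set.mem_iUnion.1 hω
  exact ⟨n + r, by omega, hn⟩

theorem green₂_zero_le_one (k : ℕ) : green₂ k 0 ≤ 1 := by
  have h (m : ℕ) : pathWeight (fun _ _ => True) m = (transfer ^ m) (Pi.single 0 1) := by
    induction m with
    | zero => rfl
    | succ m ih =>
      funext x
      rw [pathWeight_succ, if_pos trivial, ih, pow_succ', Module.End.mul_apply]
  have := (tsum_pathWeight_le 0 (C := fun _ _ => True) trivial k 0).trans prob_le_one
  simpa [h, green₂] using this

/-! ### Asymptotics of the Green functions -/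

/-- Finiteness at `0` is a probability bound. It propagates because `stepWeight (y + 1) * green₂ k
(y + 1)` is one of the summands of `green₂ k y`, with a positive coefficient. -/
theorem green₂_ne_top (k y : ℕ) : green₂ k y ≠ ∞ := by
  have hpos (y : ℕ) : ENNReal.ofReal (stepWeight (y + 1)) ≠ 0 :=
    (ENNReal.ofReal_pos.2 (stepWeight_pos y)).ne'
  have key (y : ℕ) {a b : ℝ≥0∞} (hb : b ≠ ∞)
      (h : ENNReal.ofReal (stepWeight (y + 1)) * a ≤ b) : a ≠ ∞ := by
    rintro rfl
    rw [ENNReal.mul_top (hpos y)] at h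
    exact hb (top_le_iff.1 h)
  induction y with
  | zero => exact ne_top_of_le_ne_top ENNReal.one_ne_top (green₂_zero_le_one k)
  | succ y ih =>
    refine key y ih ?_
    cases y with
    | zero => rw [green₂_zero_right k]; exact le_add_self
    | succ y =>
      conv_rhs => rw [green₂_succ_right]
      exact le_add_self.trans le_add_self

theorem green_ne_top (k y : ℕ) : green k y ≠ ∞ :=
  ne_top_of_le_ne_top (green₂_ne_top k y) (green_le_green₂ k y)

theorem toReal_transfer_succ {f : ℕ → ℝ≥0∞} (hf : ∀ x, f x ≠ ∞) (x : ℕ) :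
    (transfer f (x + 1)).toReal =
      survival (x + 1) * (((f x).toReal + (f (x + 1)).toReal + (f (x + 2)).toReal) / 3) := by
  rw [transfer_apply', ENNReal.toReal_mul, ENNReal.toReal_ofReal (stepWeight_nonneg _),
    ENNReal.toReal_add (by simp [hf]) (hf _), ENNReal.toReal_add (hf _) (hf _), stepWeight]
  simp only [Nat.add_sub_cancel]
  ring

theorem transfer_ne_top {f : ℕ → ℝ≥0∞} (hf : ∀ x, f x ≠ ∞) (x : ℕ) : transfer f x ≠ ∞ := by
  rw [transfer_apply']
  exact ENNReal.mul_ne_top ENNReal.ofReal_ne_top (by simp [hf])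

theorem survival_rec (x : ℕ) : 1 - survival (x + 1) = survival (x + 1) *
    (((1 - survival x) + (1 - survival (x + 1)) + (1 - survival (x + 2))) / 3) := by
  unfold survival
  push_cast
  field_simp
  ring

/-- By `survival_rec`, both sides are bounded solutions of the same equation in `k`, with value `1`
at `0`. -/
theorem green_zero_toReal (k : ℕ) : (green k 0).toReal = 1 - survival k := by
  have hle (x : ℕ) : (green x 0).toReal ≤ 1 := ENNReal.toReal_le_of_le_ofReal zero_le_one
    (by simpa using (green_le_green₂ x 0).trans (green₂_zero_le_one x))
  have := homogeneous_bounded_eq_zero (δ := fun x => (green x 0).toReal - (1 - survival x))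
    (M := 1) (by
      rw [green_left, transfer_apply_zero]
      simp [survival])
    (fun x => abs_le.2 ⟨by
      linarith [survival_nonneg x, ENNReal.toReal_nonneg (a := green x 0)], by
      linarith [hle x, survival_le_one x]⟩)
    (fun x => by
      have h1 := survival_rec x
      have h2 := toReal_transfer_succ (fun x => green_ne_top x 0) x
      have h3 := congrArg ENNReal.toReal (green_left (x + 1) 0)
      rw [Pi.single_eq_of_ne (Nat.succ_ne_zero x), zero_add, h2] at h3
      linarith) k
  linarith

/-- The constant `1` solves the equation in `k`, since `1 = (1 - survival k) + survival k * 1`. -/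
theorem green₂_zero_toReal (k : ℕ) : (green₂ k 0).toReal = 1 := by
  have hle (x : ℕ) : (green₂ x 0).toReal ≤ 1 := ENNReal.toReal_le_of_le_ofReal zero_le_one
    (by simpa using green₂_zero_le_one x)
  have := homogeneous_bounded_eq_zero (δ := fun x => (green₂ x 0).toReal - 1)
    (M := 1) (by
      rw [green₂_left, transfer_apply_zero, green_left, transfer_apply_zero]
      simp)
    (fun x => abs_le.2 ⟨by linarith [ENNReal.toReal_nonneg (a := green₂ x 0)], by
      linarith [hle x]⟩)
    (fun x => by
      have h1 := survival_rec x
      have h2 := toReal_transfer_succ (fun x => green₂_ne_top x 0) x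
      have h3 := congrArg ENNReal.toReal (green₂_left (x + 1) 0)
      rw [ENNReal.toReal_add (green_ne_top _ _)
        (transfer_ne_top (fun x => green₂_ne_top x 0) _), h2, green_zero_toReal] at h3
      linarith) k
  linarith

theorem toReal_green_rec (k y : ℕ) : (green k (y + 1)).toReal =
    (Pi.single (y + 1) 1 : ℕ → ℝ) k + (stepWeight y * (green k y).toReal +
      stepWeight (y + 1) * (green k (y + 1)).toReal +
      stepWeight (y + 2) * (green k (y + 2)).toReal) := by
  have h (a z : ℕ) : ENNReal.ofReal (stepWeight a) * green k z ≠ ∞ :=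
    ENNReal.mul_ne_top ENNReal.ofReal_ne_top (green_ne_top k z)
  have hs : (Pi.single (y + 1) 1 : ℕ → ℝ≥0∞) k ≠ ∞ ∧
      ((Pi.single (y + 1) 1 : ℕ → ℝ≥0∞) k).toReal = (Pi.single (y + 1) 1 : ℕ → ℝ) k := by
    simp only [Pi.single_apply]
    split_ifs <;> simp
  conv_lhs => rw [green_succ_right]
  rw [ENNReal.toReal_add hs.1 (by simp [h]), hs.2, ENNReal.toReal_add (by simp [h]) (h _ _),
    ENNReal.toReal_add (h _ _) (h _ _)]
  simp only [ENNReal.toReal_mul, ENNReal.toReal_ofReal (stepWeight_nonneg _)]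

theorem toReal_green₂_rec (k y : ℕ) : (green₂ k (y + 1)).toReal =
    (green k (y + 1)).toReal + (stepWeight y * (green₂ k y).toReal +
      stepWeight (y + 1) * (green₂ k (y + 1)).toReal +
      stepWeight (y + 2) * (green₂ k (y + 2)).toReal) := by
  have h (a z : ℕ) : ENNReal.ofReal (stepWeight a) * green₂ k z ≠ ∞ :=
    ENNReal.mul_ne_top ENNReal.ofReal_ne_top (green₂_ne_top k z)
  conv_lhs => rw [green₂_succ_right]
  rw [ENNReal.toReal_add (green_ne_top _ _) (by simp [h]), ENNReal.toReal_add (by simp [h]) (h _ _),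
    ENNReal.toReal_add (h _ _) (h _ _)]
  simp only [ENNReal.toReal_mul, ENNReal.toReal_ofReal (stepWeight_nonneg _)]

theorem tendsto_single (y : ℕ) :
    Tendsto (fun k => (Pi.single y 1 : ℕ → ℝ) k) atTop (𝓝 0) := by
  refine tendsto_const_nhds.congr' ?_
  filter_upwards [eventually_gt_atTop y] with k hk
  rw [Pi.single_eq_of_ne hk.ne']

theorem tendsto_survival : Tendsto (fun k => 1 - survival k) atTop (𝓝 0) := by
  have h : ∀ k : ℕ, 1 - survival k = 2 * (1 / ((k : ℝ) + 1)) * (1 / ((k + 1 : ℕ) + 1 : ℝ)) := by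
    intro k
    unfold survival
    push_cast
    field_simp
    ring
  simp only [h]
  have h1 := tendsto_one_div_add_atTop_nhds_zero_nat (𝕜 := ℝ)
  simpa using (h1.const_mul 2).mul ((tendsto_add_atTop_iff_nat 1).2 h1)

theorem tendsto_green (y : ℕ) : Tendsto (fun k => (green k y).toReal) atTop (𝓝 0) := by
  suffices h : Tendsto (fun k => (green k y).toReal) atTop (𝓝 0) ∧
      Tendsto (fun k => (green k (y + 1)).toReal) atTop (𝓝 0) from h.1
  induction y with
  | zero =>
    have h0 : Tendsto (fun k => (green k 0).toReal) atTop (𝓝 0) := by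
      simp only [green_zero_toReal]; exact tendsto_survival
    refine ⟨h0, ?_⟩
    have hle (k : ℕ) : (green k 1).toReal ≤ (green k 0).toReal / stepWeight 1 := by
      rw [le_div_iff₀ (stepWeight_pos 0), mul_comm,
        ← ENNReal.toReal_ofReal (stepWeight_nonneg 1), ← ENNReal.toReal_mul]
      refine ENNReal.toReal_mono (green_ne_top k 0) ?_
      rw [green_zero_right]
      exact le_add_self
    refine squeeze_zero (fun k => ENNReal.toReal_nonneg) hle ?_
    simpa using h0.div_const (stepWeight 1)
  | succ y ih =>
    refine ⟨ih.2, ?_⟩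
    have h (k : ℕ) : (green k (y + 2)).toReal = ((green k (y + 1)).toReal -
        (Pi.single (y + 1) 1 : ℕ → ℝ) k - stepWeight y * (green k y).toReal -
        stepWeight (y + 1) * (green k (y + 1)).toReal) / stepWeight (y + 2) := by
      rw [eq_div_iff (stepWeight_pos (y + 1)).ne']
      linarith [toReal_green_rec k y]
    simp only [h]
    simpa using (((ih.2.sub (tendsto_single (y + 1))).sub (ih.1.const_mul (stepWeight y))).sub
      (ih.2.const_mul (stepWeight (y + 1)))).div_const (stepWeight (y + 2))

/-- The limit of `green₂ k y` as `k → ∞`. -/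
def greenLimit (y : ℕ) : ℝ :=
  if y = 0 then 1 else 3 / 20 * ((y + 1) * (y + 2) * (2 * y + 3))

theorem greenLimit_nonneg (y : ℕ) : 0 ≤ greenLimit y := by
  unfold greenLimit; split_ifs <;> positivity

theorem greenLimit_succ (y : ℕ) :
    greenLimit (y + 1) = 3 / 20 * ((y + 2) * (y + 3) * (2 * y + 5)) := by
  unfold greenLimit
  rw [if_neg (Nat.succ_ne_zero y)]
  push_cast
  ring

/-- The value at `0` lies off the cubic, which would give `9/10`; here this is invisible because
`stepWeight 0 = 0`. -/
theorem greenLimit_rec (y : ℕ) : greenLimit (y + 1) = stepWeight y * greenLimit y +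
    stepWeight (y + 1) * greenLimit (y + 1) + stepWeight (y + 2) * greenLimit (y + 2) := by
  rw [greenLimit_succ, greenLimit_succ]
  rcases y with _ | y
  · simp [stepWeight, survival]; norm_num
  · rw [greenLimit_succ]
    unfold stepWeight survival
    push_cast
    field_simp
    ring

/-- The recursion in `y` expresses each value through the two preceding ones; its source term
`green` disappears in the limit. -/
theorem tendsto_toReal_green₂ (y : ℕ) :
    Tendsto (fun k => (green₂ k y).toReal) atTop (𝓝 (greenLimit y)) := by
  suffices h : Tendsto (fun k => (green₂ k y).toReal) atTop (𝓝 (greenLimit y)) ∧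
      Tendsto (fun k => (green₂ k (y + 1)).toReal) atTop (𝓝 (greenLimit (y + 1))) from h.1
  induction y with
  | zero =>
    have h0 : Tendsto (fun k => (green₂ k 0).toReal) atTop (𝓝 1) := by
      simp only [green₂_zero_toReal]; exact tendsto_const_nhds
    refine ⟨by simpa [greenLimit] using h0, ?_⟩
    have h (k : ℕ) : (green₂ k (0 + 1)).toReal =
        ((green₂ k 0).toReal - (green k 0).toReal) / stepWeight 1 := by
      rw [eq_div_iff (stepWeight_pos 0).ne', green₂_zero_right, ENNReal.toReal_add (green_ne_top _ _)
        (ENNReal.mul_ne_top ENNReal.ofReal_ne_top (green₂_ne_top k 1)), ENNReal.toReal_mul,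
        ENNReal.toReal_ofReal (stepWeight_nonneg 1)]
      ring
    simp only [h]
    convert (h0.sub (tendsto_green 0)).div_const (stepWeight 1) using 2
    rw [greenLimit_succ]
    simp [stepWeight, survival]
    norm_num
  | succ y ih =>
    refine ⟨ih.2, ?_⟩
    have h (k : ℕ) : (green₂ k (y + 2)).toReal = ((green₂ k (y + 1)).toReal -
        (green k (y + 1)).toReal - stepWeight y * (green₂ k y).toReal -
        stepWeight (y + 1) * (green₂ k (y + 1)).toReal) / stepWeight (y + 2) := by
      rw [eq_div_iff (stepWeight_pos (y + 1)).ne']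
      linarith [toReal_green₂_rec k y]
    simp only [h]
    convert (((ih.2.sub (tendsto_green (y + 1))).sub (ih.1.const_mul (stepWeight y))).sub
      (ih.2.const_mul (stepWeight (y + 1)))).div_const (stepWeight (y + 2)) using 2
    rw [eq_div_iff (stepWeight_pos (y + 1)).ne']
    linarith [greenLimit_rec y]

theorem tendsto_green₂ (y : ℕ) :
    Tendsto (fun k => green₂ k y) atTop (𝓝 (ENNReal.ofReal (greenLimit y))) := by
  have := ENNReal.tendsto_ofReal (tendsto_toReal_green₂ y)
  simpa only [ENNReal.ofReal_toReal (green₂_ne_top _ _)] using this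

/-! ### Point masses of the limit -/

/-- The weight of the path with shifted labels `c r, …, c 0`. -/
def chainWeight (c : ℕ → ℕ) : ℕ → ℝ≥0∞
  | 0 => 1
  | r + 1 => transfer (Pi.single (c r) 1) (c (r + 1)) * chainWeight c r

theorem chainWeight_ne_top (c : ℕ → ℕ) (r : ℕ) : chainWeight c r ≠ ∞ := by
  induction r with
  | zero => exact ENNReal.one_ne_top
  | succ r ih =>
    refine ENNReal.mul_ne_top (transfer_ne_top (fun x => ?_) _) ih
    rw [Pi.single_apply]
    split_ifs <;> simp

/-- The constraint fixes the labels up to distance `r` from the hit and leaves the remaining `n`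
steps free. -/
theorem pathWeight_eq_chainWeight {c : ℕ → ℕ} (h0 : c 0 = 0) (r n : ℕ) :
    pathWeight (fun i a => i ≤ r → a = c i) (n + r) =
      chainWeight c r • (transfer ^ n) (Pi.single (c r) 1) := by
  have key : ∀ m ≤ r, pathWeight (fun i a => i ≤ r → a = c i) m =
      chainWeight c m • (Pi.single (c m) 1 : ℕ → ℝ≥0∞) := by
    intro m hm
    induction m with
    | zero => simp [pathWeight, chainWeight, h0]
    | succ m ih =>
      funext x
      rw [pathWeight_succ, ih (by omega), map_smul, chainWeight]
      by_cases hx : x = c (m + 1)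
      · subst hx
        simp [mul_comm]
      · have : ¬ (m + 1 ≤ r → x = c (m + 1)) := fun h => hx (h hm)
        rw [if_neg this]
        simp [Pi.single_eq_of_ne hx]
  induction n with
  | zero => simpa using key r le_rfl
  | succ n ih =>
    funext x
    rw [show n + 1 + r = n + r + 1 by omega, pathWeight_succ, if_pos (fun h => by omega), ih, map_smul,
      pow_succ', Module.End.mul_apply]

theorem chainWeight_mul_green₂_le {c : ℕ → ℕ} (h0 : c 0 = 0) (r k : ℕ) :
    chainWeight c r * green₂ k (c r) ≤
      sampleLaw {ω | ∀ i < r, (uniformInfiniteTree ω).branchLabel k (i + 1) = c (i + 1)} := by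
  have h := tsum_pathWeight_le (-(k : ℤ)) (C := fun i a => i ≤ r → a = c i) (fun _ => h0.symm) k r
  simp only [pathWeight_eq_chainWeight h0, Pi.smul_apply, smul_eq_mul, neg_add_cancel,
    spineTree_zero] at h
  refine le_trans ?_ (h.trans (measure_mono ?_))
  · rw [green₂, ← ENNReal.tsum_mul_left]
    refine ENNReal.tsum_le_tsum fun n => ?_
    rw [mul_left_comm]
    -- Replacing `n + r + 1` by `n + 1` discards only `r * green k (c r)` times the path weight,
    -- which tends to `0` with `k`.
    gcongr
    omega
  · rintro ω ⟨m, hm, hω⟩ i hi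
    obtain ⟨a, ha, hb⟩ := hω.branchLabel_eq (i := i + 1) (by omega)
    rw [hb, ha (by omega)]

/-! ### Point masses of the Markov chain -/

instance : IsProbabilityMeasure chainLaw := by
  unfold chainLaw; infer_instance

theorem chainLaw_zero (a : ℕ) : chainLaw {x | x 0 = a} = (Pi.single 1 1 : ℕ → ℝ≥0∞) a := by
  have hS : MeasurableSet {h : Finset.Iic 0 → ℕ | h ⟨0, by simp⟩ = a} :=
    MeasurableSet.of_discrete
  have h1 : chainLaw.map (Preorder.frestrictLe 0) =
      (Measure.dirac 1).map (MeasurableEquiv.piUnique (fun _ : Finset.Iic 0 => ℕ)).symm := by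
    rw [chainLaw, Kernel.trajMeasure, Measure.map_comp _ _ (by fun_prop),
      Kernel.traj_map_frestrictLe, Kernel.partialTraj_self, Measure.id_comp]
  have h2 : chainLaw {x | x 0 = a} = chainLaw.map (Preorder.frestrictLe 0)
      {h : Finset.Iic 0 → ℕ | h ⟨0, by simp⟩ = a} := by
    rw [Measure.map_apply (by fun_prop) hS]
    rfl
  rw [h2, h1, Measure.map_apply (MeasurableEquiv.measurable _) hS,
    Measure.dirac_apply' _ (MeasurableEquiv.measurable _ hS)]
  by_cases ha : a = 1
  · subst ha
    rw [Pi.single_eq_same]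
    exact Set.indicator_of_mem (by rfl) _
  · rw [Pi.single_eq_of_ne ha]
    apply Set.indicator_of_notMem
    exact fun h => ha (Eq.symm h)

theorem chainLaw_succ (c : ℕ → ℕ) (n : ℕ) :
    chainLaw {x | ∀ i ≤ n + 1, x i = c i} =
      chainStep (c n) {c (n + 1)} * chainLaw {x | ∀ i ≤ n, x i = c i} := by
  have h := Kernel.map_frestrictLe_trajMeasure_compProd_eq_map_trajMeasure
    (X := fun _ => ℕ) (μ₀ := Measure.dirac 1) (κ := chainKernel) (a := n)
  let S : Set (Finset.Iic n → ℕ) := {h | ∀ i : Finset.Iic n, h i = c i}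
  have hS : MeasurableSet S := MeasurableSet.of_discrete
  have h1 := DFunLike.congr_fun h (S ×ˢ {c (n + 1)})
  rw [Measure.compProd_apply_prod hS (measurableSet_singleton _),
    setLIntegral_congr_fun (g := fun _ => chainStep (c n) {c (n + 1)}) hS, setLIntegral_const,
    Measure.map_apply (by fun_prop) hS, Measure.map_apply (by fun_prop)
      (hS.prod (measurableSet_singleton _))] at h1
  · have e1 : {x : ℕ → ℕ | ∀ i ≤ n, x i = c i} = Preorder.frestrictLe n ⁻¹' S := by
      ext x
      simp [S, Preorder.frestrictLe]
    have e2 : {x : ℕ → ℕ | ∀ i ≤ n + 1, x i = c i} =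
        (fun x : ℕ → ℕ => (Preorder.frestrictLe (π := fun _ => ℕ) n x, x (n + 1))) ⁻¹'
          (S ×ˢ {c (n + 1)}) := by
      ext x
      simp only [S, Set.mem_ofPred_eq, Set.mem_preimage, Set.mem_prod, Set.mem_singleton_iff,
        Preorder.frestrictLe, Subtype.forall, Finset.mem_Iic]
      constructor
      · exact fun h => ⟨fun i hi => h i (by omega), h _ le_rfl⟩
      · rintro ⟨h, h'⟩ i hi
        rcases hi.lt_or_eq with hi | rfl
        · exact h i (by omega)
        · exact h'
    rw [e1, e2, chainLaw]
    exact h1.symm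
  · intro x hx
    have : x ⟨n, by simp⟩ = c n := hx ⟨n, by simp⟩
    change chainStep (x ⟨n, _⟩) {c (n + 1)} = _
    rw [this]

/-- This identity and the next two say that the transition probabilities are the Doob transform of
the kernel by `greenLimit`. For `a = 0` both sides vanish. -/
theorem stepWeight_mul_greenLimit_down (a : ℕ) :
    stepWeight a * greenLimit a = greenLimit (a + 1) * probDown (a + 1) := by
  rw [greenLimit_succ]
  rcases a with _ | a
  · simp [stepWeight, survival, probDown]
  · rw [greenLimit_succ]
    unfold stepWeight survival probDown
    push_cast
    field_simp
    ring

theorem stepWeight_mul_greenLimit_stay (a : ℕ) :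
    stepWeight (a + 1) * greenLimit (a + 1) = greenLimit (a + 1) * probStay (a + 1) := by
  unfold stepWeight survival probStay
  field_simp

theorem stepWeight_mul_greenLimit_up (a : ℕ) :
    stepWeight (a + 2) * greenLimit (a + 2) = greenLimit (a + 1) * probUp (a + 1) := by
  rw [greenLimit_succ, greenLimit_succ]
  unfold stepWeight survival probUp
  push_cast
  field_simp
  ring

theorem transfer_single_mul_greenLimit (a b : ℕ) :
    transfer (Pi.single (a + 1) 1) b * ENNReal.ofReal (greenLimit b) =
      ENNReal.ofReal (greenLimit (a + 1)) * chainStep (a + 1) {b} := by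
  have hs : chainStep (a + 1) {b} =
      ENNReal.ofReal (probUp (a + 1)) * (Pi.single (a + 2) 1 : ℕ → ℝ≥0∞) b +
      ENNReal.ofReal (probStay (a + 1)) * (Pi.single (a + 1) 1 : ℕ → ℝ≥0∞) b +
      ENNReal.ofReal (probDown (a + 1)) * (Pi.single a 1 : ℕ → ℝ≥0∞) b := by
    have hd (z : ℕ) : Measure.dirac z {b} = (Pi.single z 1 : ℕ → ℝ≥0∞) b := by
      rw [Measure.dirac_apply, Pi.single_apply, Set.indicator_apply]
      simp [eq_comm]
    rw [chainStep, if_neg (Nat.succ_ne_zero a)]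
    simp [hd]
  have hg (x z : ℕ) (p : ℝ) (h : stepWeight z * greenLimit z = greenLimit x * p) :
      ENNReal.ofReal (stepWeight z) * (Pi.single z 1 : ℕ → ℝ≥0∞) b *
        ENNReal.ofReal (greenLimit b) =
      ENNReal.ofReal (greenLimit x) * (ENNReal.ofReal p * (Pi.single z 1 : ℕ → ℝ≥0∞) b) := by
    by_cases hz : b = z
    · subst hz
      simp only [Pi.single_eq_same, mul_one]
      rw [← ENNReal.ofReal_mul (stepWeight_nonneg _), ← ENNReal.ofReal_mul (greenLimit_nonneg _), h]
    · simp [Pi.single_eq_of_ne hz]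
  rw [transfer_single_succ, hs]
  simp only [Pi.add_apply, Pi.smul_apply, smul_eq_mul, add_mul, mul_add]
  rw [hg _ _ _ (stepWeight_mul_greenLimit_down a), hg _ _ _ (stepWeight_mul_greenLimit_stay a),
    hg _ _ _ (stepWeight_mul_greenLimit_up a)]
  ring

/-- The factors `greenLimit` telescope along the path by `transfer_single_mul_greenLimit`. -/
theorem chainLaw_le (c : ℕ → ℕ) (h0 : c 0 = 0) (r : ℕ) :
    chainLaw {x | ∀ i < r, x i = c (i + 1)} ≤
      chainWeight c r * ENNReal.ofReal (greenLimit (c r)) := by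
  rcases r with _ | r
  · simp [chainWeight, h0, greenLimit]
  induction r with
  | zero =>
    have : {x : ℕ → ℕ | ∀ i < 0 + 1, x i = c (i + 1)} = {x | x 0 = c 1} := by
      ext x; simp
    rw [this, chainLaw_zero]
    by_cases h1 : c 1 = 1
    -- The product `2/9 * 9/2` gives the start at `1` its full mass.
    · have e : stepWeight 1 * greenLimit 1 = 1 := by
        rw [greenLimit_succ]; norm_num [stepWeight, survival]
      rw [h1, chainWeight, chainWeight, h0, transfer_single_zero]
      simp only [zero_add, h1, Pi.smul_apply, Pi.single_eq_same, smul_eq_mul, mul_one]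
      rw [← ENNReal.ofReal_mul (stepWeight_nonneg _), e, ENNReal.ofReal_one]
    · rw [Pi.single_eq_of_ne h1]; exact zero_le
  | succ r ih =>
    have hle (r : ℕ) : {x : ℕ → ℕ | ∀ i < r + 1, x i = c (i + 1)} =
        {x | ∀ i ≤ r, x i = (fun j => c (j + 1)) i} := by
      ext x; simp
    rcases hc : c (r + 1) with _ | a
    -- A path through `0` has weight zero, so by induction the chain already gives mass zero to its
    -- initial segment.
    · have hz : chainWeight c (r + 1) = 0 := by
        rw [chainWeight, hc, transfer_apply_zero, zero_mul]
      rw [hz, zero_mul] at ih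
      exact le_trans (measure_mono fun x (hx : ∀ i < r + 1 + 1, x i = c (i + 1)) i hi =>
        hx i (Nat.lt_succ_of_lt hi)) (ih.trans zero_le)
    · rw [hle, chainLaw_succ, ← hle]
      refine (mul_le_mul_right ih _).trans (le_of_eq ?_)
      have := transfer_single_mul_greenLimit a (c (r + 1 + 1))
      rw [chainWeight.eq_2 c (r + 1)]
      simp only [hc]
      rw [mul_right_comm, this]
      ring

/-! ### Convergence in distribution -/

/-- Fatou's lemma for the counting measure on the atoms lying in an open set gives the portmanteau
criterion. No upper bound or tightness is needed, since `ν` has total mass one. -/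
theorem tendsto_of_liminf_singleton {ι Ω : Type*} [Countable ι] [MeasurableSpace ι]
    [DiscreteMeasurableSpace ι] [MeasurableSpace Ω] [TopologicalSpace Ω]
    [OpensMeasurableSpace Ω] [HasOuterApproxClosed Ω] [MeasurableSingletonClass Ω] {e : ι → Ω}
    (he : Function.Injective e) (ν : ProbabilityMeasure ι) {μ : ProbabilityMeasure Ω}
    (hμ : (μ : Measure Ω) = (ν : Measure ι).map e) {μs : ℕ → ProbabilityMeasure Ω}
    (h : ∀ c, (ν : Measure ι) {c} ≤ liminf (fun k => (μs k : Measure Ω) {e c}) atTop) :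
    Tendsto μs atTop (𝓝 μ) := by
  classical
  refine tendsto_of_forall_isOpen_le_liminf' fun G hG => ?_
  let A : ι → Set Ω := fun c => if e c ∈ G then {e c} else ∅
  have hA (c : ι) : MeasurableSet (A c) := by
    simp only [A]; split_ifs <;> simp
  have hAG (c : ι) : A c ⊆ G := by
    simp only [A]; split_ifs with hc <;> simp [hc]
  have hAd : Pairwise (Function.onFun Disjoint A) := by
    intro c d hcd
    have : e c ≠ e d := fun h => hcd (he h)
    simp only [Function.onFun, A]
    split_ifs <;> simp [this]
  calc (μ : Measure Ω) G = ∑' c, (e ⁻¹' G).indicator (fun c => (ν : Measure ι) {c}) c := by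
        rw [hμ, Measure.map_apply Measurable.of_discrete hG.measurableSet,
          Measure.tsum_indicator_apply_singleton _ _ (MeasurableSet.of_discrete)]
    _ ≤ ∑' c, liminf (fun k => (μs k : Measure Ω) (A c)) atTop := by
        refine ENNReal.tsum_le_tsum fun c => ?_
        by_cases hc : e c ∈ G
        · simp only [A, hc, if_true]
          exact (Set.indicator_le_self' (fun _ _ => zero_le) c).trans (h c)
        · rw [Set.indicator_of_notMem (by exact hc)]
          exact zero_le
    _ = ∫⁻ c, liminf (fun k => (μs k : Measure Ω) (A c)) atTop ∂Measure.count := by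
        rw [lintegral_count]
    _ ≤ liminf (fun k => ∫⁻ c, (μs k : Measure Ω) (A c) ∂Measure.count) atTop :=
        lintegral_liminf_le fun k => Measurable.of_discrete
    _ ≤ liminf (fun k => (μs k : Measure Ω) G) atTop := by
        refine liminf_le_liminf (Eventually.of_forall fun k => ?_)
        rw [lintegral_count, ← measure_iUnion hAd hA]
        exact measure_mono (Set.iUnion_subset hAG)

theorem chainLaw_singleton_le (r : ℕ) (c : Fin r → ℕ) :
    chainLaw {x | (fun i : Fin r => x i) = c} ≤
      liminf (fun k => sampleLaw {ω | firstLabels r k ω = fun i => (c i : ℝ)}) atTop := by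
  -- The path `c` moved by one index, with the shifted label `0` of `e_k` in front; `i ≠ 0` excludes
  -- the truncated `0 - 1`.
  let d : ℕ → ℕ := fun i => if h : i - 1 < r ∧ i ≠ 0 then c ⟨i - 1, h.1⟩ else 0
  have hd (i : ℕ) (hi : i < r) : d (i + 1) = c ⟨i, hi⟩ := by simp [d, hi]
  have hd0 : d 0 = 0 := by simp [d]
  have h1 : {x : ℕ → ℕ | (fun i : Fin r => x i) = c} = {x | ∀ i < r, x i = d (i + 1)} := by
    ext x
    simp only [Set.mem_ofPred_eq, funext_iff, Fin.forall_iff]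
    exact forall₂_congr fun i hi => by rw [hd i hi]
  have h2 (k : ℕ) : {ω | firstLabels r k ω = fun i => (c i : ℝ)} =
      {ω | ∀ i < r, (uniformInfiniteTree ω).branchLabel k (i + 1) = d (i + 1)} := by
    ext ω
    simp only [Set.mem_ofPred_eq, funext_iff, Fin.forall_iff, firstLabels]
    exact forall₂_congr fun i hi => by rw [hd i hi]; norm_cast
  have h3 := ENNReal.Tendsto.const_mul (tendsto_green₂ (d r)) (Or.inr (chainWeight_ne_top d r))
  rw [h1]
  refine (chainLaw_le d hd0 r).trans ?_
  rw [← h3.liminf_eq]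
  refine liminf_le_liminf (Eventually.of_forall fun k => ?_)
  rw [h2 k]
  exact chainWeight_mul_green₂_le hd0 r k

end UIPQ

end

/-- The first `r` labels on the branch from `e_k` converge in distribution, as `k → ∞`, to the
first `r` values of the Markov chain started from `1`. -/
theorem mainTheorem6 (r : ℕ) :
    (∀ k : ℕ, Measurable (UIPQ.firstLabels r k)) ∧
    ∀ F : (Fin r → ℝ) →ᵇ ℝ,
      Tendsto (fun k : ℕ => ∫ ω, F (UIPQ.firstLabels r k ω) ∂UIPQ.sampleLaw) atTop
        (𝓝 (∫ x : ℕ → ℕ, F (fun i : Fin r => (x i : ℝ)) ∂UIPQ.chainLaw)) := by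
  refine ⟨UIPQ.measurable_firstLabels r, fun F => ?_⟩
  have hp : Measurable fun (x : ℕ → ℕ) (i : Fin r) => x i := by fun_prop
  have he : Measurable fun (c : Fin r → ℕ) (i : Fin r) => (c i : ℝ) := Measurable.of_discrete
  have hm : Measurable fun (x : ℕ → ℕ) (i : Fin r) => (x i : ℝ) := he.comp hp
  let ν : ProbabilityMeasure (Fin r → ℕ) :=
    ⟨UIPQ.chainLaw.map fun x i => x i, Measure.isProbabilityMeasure_map hp.aemeasurable⟩
  let μ : ProbabilityMeasure (Fin r → ℝ) :=
    ⟨UIPQ.chainLaw.map fun x i => (x i : ℝ), Measure.isProbabilityMeasure_map hm.aemeasurable⟩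
  let μs (k : ℕ) : ProbabilityMeasure (Fin r → ℝ) :=
    ⟨UIPQ.sampleLaw.map (UIPQ.firstLabels r k),
      Measure.isProbabilityMeasure_map (UIPQ.measurable_firstLabels r k).aemeasurable⟩
  have hμ : (μ : Measure (Fin r → ℝ)) = (ν : Measure (Fin r → ℕ)).map
      fun (c : Fin r → ℕ) (i : Fin r) => (c i : ℝ) := (Measure.map_map he hp).symm
  have hconv : Tendsto μs atTop (𝓝 μ) := by
    refine UIPQ.tendsto_of_liminf_singleton (e := fun (c : Fin r → ℕ) (i : Fin r) => (c i : ℝ))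
      (fun c d h => funext fun i => Nat.cast_injective (congrFun h i)) ν
      hμ fun c => ?_
    have h := UIPQ.chainLaw_singleton_le r c
    refine le_trans (le_of_eq ?_) (h.trans (le_of_eq ?_))
    · exact Measure.map_apply hp (measurableSet_singleton c)
    · congr 1
      funext k
      exact (Measure.map_apply (UIPQ.measurable_firstLabels r k) (measurableSet_singleton _)).symm
  have h := ProbabilityMeasure.tendsto_iff_forall_integral_tendsto.1 hconv F
  have hF : StronglyMeasurable F := F.continuous.stronglyMeasurable
  have e1 : ∫ x, F x ∂(μ : Measure (Fin r → ℝ)) =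
      ∫ x : ℕ → ℕ, F (fun i : Fin r => (x i : ℝ)) ∂UIPQ.chainLaw :=
    integral_map hm.aemeasurable hF.aestronglyMeasurable
  have e2 (k : ℕ) : ∫ x, F x ∂(μs k : Measure (Fin r → ℝ)) =
      ∫ ω, F (UIPQ.firstLabels r k ω) ∂UIPQ.sampleLaw :=
    integral_map (UIPQ.measurable_firstLabels r k).aemeasurable hF.aestronglyMeasurable
  rw [← e1]
  simpa only [e2] using h
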